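/- Let $N\ge 1$ and let $\mathcal T$ be a star-shaped network with $N$ edges of lengths $\ell_1,\dots,\ell_N>0$, the $j$-th edge being parametrized by $x\in[0,\ell_j]$ with $x=0$ at the common central node. Let $$\mathbb H^1_e(\mathcal T)=\Big\{\underline u=(u_1,\dots,u_N)\in\bigoplus_{j=1}^N H^1(0,\ell_j;\mathbb C):\ u_j(\ell_j)=0,\ u_j(0)=u_k(0)\ \text{for all } j,k\Big\},$$ with the norm $\|\underline u\|^2=\sum_{j=1}^N\int_0^{\ell_j}\big(|u_j|^2+|\partial_xu_j|^2\big)\,dx$, and let $\alpha>N/2$. Consider the linearized Benjamin–Bona–Mahony system (LBBM) $$\begin{cases}\partial_tu_j-\partial_x^2\partial_tu_j+\partial_xu_j=0, & x\in(0,\ell_j),\ t>0,\ j=1,\dots,N,\\ u_j(t,0)=u_k(t,0), & j,k=1,\dots,N,\\ \sum_{j=1}^N\partial_x\partial_tu_j(t,0)=\alpha\,u_1(t,0), & t>0,\\ u_j(t,\ell_j)=0, & t>0,\ j=1,\dots,N,\\ \underline u(0,\cdot)=\underline u^0.\end{cases}$$ Let $\mathcal A$ be the bounded operator on $\mathbb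 H^1_e(\mathcal T)$ for which $\underline v=\mathcal A\underline u\in\mathbb H^1_e(\mathcal T)$ is the solution of $v_j-\partial_x^2v_j=-\partial_xu_j$ on $(0,\ell_j)$, $v_j(0)=v_k(0)$, $\sum_{j}\partial_xv_j(0)=\alpha u_1(0)$, $v_j(\ell_j)=0$. Call $\underline u\in C([0,\infty),\mathbb H^1_e(\mathcal T))$ a solution of (LBBM) if $\underline u(0)=\underline u^0$ and, at every $t>0$, $\underline u$ is differentiable with values in $\mathbb H^1_e(\mathcal T)$, $\partial_tu_j(t)\in H^2(0,\ell_j)$, and the equations above hold (the first one in $L^2(0,\ell_j)$). Then for every $\underline u^0\in\mathbb H^1_e(\mathcal T)$ the system (LBBM) has exactly one solution, namely $\underline u(t)=e^{t\mathcal A}\underline u^0$. Moreover, the system is strongly stable, that is, $$\lim_{t\to+\infty}\big\|e^{t\mathcal A}\underline u^0\big\|_{\mathbb H^1_e(\mathcal T)}=0\qquad\text{for all }\underline u^0\in\mathbb H^1_e(\mathcal T),$$ if and only if $$\frac{\ell_i}{\ell_j}\notin\mathbb Q\qquad\text{for all }1\le i\ne j\le N.$$ -/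

import Mathlib

open MeasureTheory Filter Topology

/-- A star-shaped network: `N` edges, the `j`-th one parametrized by arc length on `[0, length j]`,
the parameter `0` being the central node on every edge. -/
structure StarNetwork (N : ℕ) where
  length : Fin N → ℝ
  length_pos : ∀ j, 0 < length j

/-- `L²(0, L)`, complex valued. -/
noncomputable abbrev EdgeL2 (L : ℝ) := Lp ℂ 2 (volume.restrict (Set.Ioc (0 : ℝ) L))

/-- `f` is the absolutely continuous representative on `[0, L]` of `v ∈ H¹(0, L)`, whose
weak derivative is `dv ∈ L²(0, L)`. -/
def IsACRep (L : ℝ) (f : ℝ → ℂ) (v dv : EdgeL2 L) : Prop :=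
  (∀ᵐ x ∂(volume.restrict (Set.Ioc (0 : ℝ) L)), v x = f x) ∧
    ∀ x ∈ Set.Icc (0 : ℝ) L, f x = f 0 + ∫ s in (0 : ℝ)..x, dv s

theorem EdgeL2.intervalIntegrable {L : ℝ} (g : EdgeL2 L) {x : ℝ} (hx : x ∈ Set.Icc (0 : ℝ) L) :
    IntervalIntegrable g volume 0 x := by
  rw [intervalIntegrable_iff_integrableOn_Ioc_of_le hx.1]
  have h : Integrable g (volume.restrict (Set.Ioc (0 : ℝ) L)) :=
    (Lp.memLp g).integrable (by norm_num)
  exact IntegrableOn.mono_set h (Set.Ioc_subset_Ioc_right hx.2)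

theorem EdgeL2.integral_congr {L : ℝ} {g h : ℝ → ℂ}
    (hgh : g =ᵐ[volume.restrict (Set.Ioc (0 : ℝ) L)] h) {x : ℝ} (hx : x ∈ Set.Icc (0 : ℝ) L) :
    ∫ s in (0 : ℝ)..x, g s = ∫ s in (0 : ℝ)..x, h s := by
  rw [intervalIntegral.integral_of_le hx.1, intervalIntegral.integral_of_le hx.1]
  exact integral_congr_ae
    (ae_mono (Measure.restrict_mono (Set.Ioc_subset_Ioc_right hx.2) le_rfl) hgh)

theorem IsACRep.zero (L : ℝ) : IsACRep L (fun _ => 0) 0 0 := by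
  refine ⟨Lp.coeFn_zero _ _ _, fun x hx => ?_⟩
  rw [EdgeL2.integral_congr (Lp.coeFn_zero _ _ _) hx]
  simp

theorem IsACRep.add {L : ℝ} {f g : ℝ → ℂ} {v dv w dw : EdgeL2 L} (hf : IsACRep L f v dv)
    (hg : IsACRep L g w dw) : IsACRep L (fun x => f x + g x) (v + w) (dv + dw) := by
  refine ⟨?_, fun x hx => ?_⟩
  · filter_upwards [hf.1, hg.1, Lp.coeFn_add v w] with x h1 h2 h3
    rw [h3, Pi.add_apply, h1, h2]
  · rw [EdgeL2.integral_congr (Lp.coeFn_add dv dw) hx]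
    simp only [Pi.add_apply]
    rw [intervalIntegral.integral_add (EdgeL2.intervalIntegrable dv hx) (EdgeL2.intervalIntegrable dw hx),
      hf.2 x hx, hg.2 x hx]
    ring

theorem IsACRep.smul {L : ℝ} {f : ℝ → ℂ} {v dv : EdgeL2 L} (c : ℂ) (hf : IsACRep L f v dv) :
    IsACRep L (fun x => c * f x) (c • v) (c • dv) := by
  refine ⟨?_, fun x hx => ?_⟩
  · filter_upwards [hf.1, Lp.coeFn_smul c v] with x h1 h3
    rw [h3, Pi.smul_apply, h1, smul_eq_mul]
  · rw [EdgeL2.integral_congr (Lp.coeFn_smul c dv) hx]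
    simp only [Pi.smul_apply, smul_eq_mul]
    rw [intervalIntegral.integral_const_mul, hf.2 x hx]
    ring

/-- The continuous functional `g ↦ ∫₀ˣ g` on `L²(0, L)`, for `x ∈ [0, L]`. -/
noncomputable def EdgeL2.primitive (L x : ℝ) : EdgeL2 L →L[ℂ] ℂ :=
  innerSL ℂ (indicatorConstLp (μ := volume.restrict (Set.Ioc (0 : ℝ) L)) 2
    (measurableSet_Ioc (a := (0 : ℝ)) (b := x)) (measure_ne_top _ _) (1 : ℂ))

theorem EdgeL2.primitive_apply {L x : ℝ} (hx : x ∈ Set.Icc (0 : ℝ) L) (g : EdgeL2 L) :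
    EdgeL2.primitive L x g = ∫ s in (0 : ℝ)..x, g s := by
  rw [EdgeL2.primitive, innerSL_apply_apply, L2.inner_indicatorConstLp_one,
    intervalIntegral.integral_of_le hx.1, Measure.restrict_restrict measurableSet_Ioc,
    Set.inter_eq_left.2 (Set.Ioc_subset_Ioc_right hx.2)]

theorem IsACRep.eq_primitive {L : ℝ} {f : ℝ → ℂ} {v dv : EdgeL2 L} (hf : IsACRep L f v dv)
    (h : f L = 0) {x : ℝ} (hx : x ∈ Set.Icc (0 : ℝ) L) :
    f x = EdgeL2.primitive L x dv - EdgeL2.primitive L L dv := by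
  have hL : L ∈ Set.Icc (0 : ℝ) L := ⟨hx.1.trans hx.2, le_rfl⟩
  rw [EdgeL2.primitive_apply hx, EdgeL2.primitive_apply hL, hf.2 x hx]
  have := hf.2 L hL
  rw [h] at this
  linear_combination -this

namespace StarNetwork

variable {N : ℕ}

/-- `𝕃²(T) = ⊕ⱼ L²(0, ℓⱼ)` with its Hilbert space structure. -/
noncomputable abbrev L2 (T : StarNetwork N) := PiLp 2 fun j : Fin N => EdgeL2 (T.length j)

/-- The space of pairs `(v, dv)` with `v, dv ∈ 𝕃²(T)`, with norm
`(∑ⱼ ‖vⱼ‖² + ‖dvⱼ‖²) ^ (1/2)`. -/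
noncomputable abbrev L2Pair (T : StarNetwork N) := WithLp 2 (T.L2 × T.L2)

/-- `ℍ¹ₑ(T)` as a subspace of `L2Pair`: each element `u` is recorded as the pair `(u, ∂ₓu)`, so that the inner product
inherited from `L2Pair` is `∑ⱼ ∫ (uⱼ v̄ⱼ + ∂ₓuⱼ ∂ₓv̄ⱼ) dx` (up to the convention on which argument
is conjugated). The conditions are `uⱼ ∈ H¹(0, ℓⱼ)`, `uⱼ(ℓⱼ) = 0` and `uⱼ(0) = uₖ(0)`. -/
noncomputable def h1eSubspace (T : StarNetwork N) : Submodule ℂ T.L2Pair where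
  carrier := {u | ∃ f : Fin N → ℝ → ℂ,
    (∀ j, IsACRep (T.length j) (f j) (u.fst j) (u.snd j)) ∧
    (∀ j, f j (T.length j) = 0) ∧ ∀ j k, f j 0 = f k 0}
  zero_mem' := ⟨fun _ _ => 0, fun j => IsACRep.zero _, fun _ => rfl, fun _ _ => rfl⟩
  add_mem' := by
    rintro u v ⟨f, hf, hf1, hf0⟩ ⟨g, hg, hg1, hg0⟩
    exact ⟨fun j x => f j x + g j x, fun j => (hf j).add (hg j),
      fun j => by simp [hf1, hg1], fun j k => by simp only [hf0 j k, hg0 j k]⟩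
  smul_mem' := by
    rintro c u ⟨f, hf, hf1, hf0⟩
    exact ⟨fun j x => c * f j x, fun j => (hf j).smul c,
      fun j => by simp [hf1], fun j k => by simp only [hf0 j k]⟩

theorem isClosed_h1eSubspace (T : StarNetwork N) : IsClosed (T.h1eSubspace : Set T.L2Pair) := by
  refine IsSeqClosed.isClosed fun u a hu ha => ?_
  have h0 : ∀ j, (0 : ℝ) ∈ Set.Icc (0 : ℝ) (T.length j) := fun j => ⟨le_rfl, (T.length_pos j).le⟩
  have hl : ∀ j, T.length j ∈ Set.Icc (0 : ℝ) (T.length j) :=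
    fun j => ⟨(T.length_pos j).le, le_rfl⟩
  choose f hf hf1 hf0 using hu
  have h1 : ∀ j, Tendsto (fun n => (u n).fst j) atTop (𝓝 (a.fst j)) := fun j =>
    (((PiLp.proj (𝕜 := ℂ) 2 (fun j : Fin N => EdgeL2 (T.length j)) j).comp
      (WithLp.fstL 2 ℂ T.L2 T.L2)).continuous.tendsto a).comp ha
  have h2 : ∀ j, Tendsto (fun n => (u n).snd j) atTop (𝓝 (a.snd j)) := fun j =>
    (((PiLp.proj (𝕜 := ℂ) 2 (fun j : Fin N => EdgeL2 (T.length j)) j).comp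
      (WithLp.sndL 2 ℂ T.L2 T.L2)).continuous.tendsto a).comp ha
  have h3 : ∀ j x, Tendsto (fun n => EdgeL2.primitive (T.length j) x ((u n).snd j)) atTop
      (𝓝 (EdgeL2.primitive (T.length j) x (a.snd j))) := fun j x =>
    ((EdgeL2.primitive (T.length j) x).continuous.tendsto _).comp (h2 j)
  refine ⟨fun j x => EdgeL2.primitive (T.length j) x (a.snd j) -
    EdgeL2.primitive (T.length j) (T.length j) (a.snd j), fun j => ⟨?_, fun x hx => ?_⟩,
    fun j => sub_self _, fun j k => ?_⟩
  · obtain ⟨ns, hns, hae⟩ := (tendstoInMeasure_of_tendsto_Lp (h1 j)).exists_seq_tendsto_ae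
    have hrep : ∀ᵐ x ∂(volume.restrict (Set.Ioc (0 : ℝ) (T.length j))),
        ∀ n, (u n).fst j x = f n j x := ae_all_iff.2 fun n => (hf n j).1
    filter_upwards [hae, hrep, ae_restrict_mem measurableSet_Ioc] with x hx hr hm
    refine tendsto_nhds_unique hx ?_
    refine (((h3 j x).sub (h3 j (T.length j))).comp hns.tendsto_atTop).congr fun n => ?_
    rw [hr (ns n), (hf (ns n) j).eq_primitive (hf1 _ j) ⟨hm.1.le, hm.2⟩, Function.comp_apply]
  · dsimp only
    rw [EdgeL2.primitive_apply (h0 j), EdgeL2.primitive_apply hx, intervalIntegral.integral_same]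
    ring
  · refine tendsto_nhds_unique ((h3 j 0).sub (h3 j (T.length j))) ?_
    refine ((h3 k 0).sub (h3 k (T.length k))).congr fun n => ?_
    rw [← (hf n j).eq_primitive (hf1 n j) (h0 j), ← (hf n k).eq_primitive (hf1 n k) (h0 k),
      hf0 n j k]

/-- The Hilbert space `ℍ¹ₑ(T)`. -/
def H1e (T : StarNetwork N) : Type := T.h1eSubspace

noncomputable instance (T : StarNetwork N) : NormedAddCommGroup T.H1e :=
  inferInstanceAs (NormedAddCommGroup T.h1eSubspace)

noncomputable instance (T : StarNetwork N) : InnerProductSpace ℂ T.H1e :=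
  inferInstanceAs (InnerProductSpace ℂ T.h1eSubspace)

instance (T : StarNetwork N) : CompleteSpace T.H1e :=
  T.isClosed_h1eSubspace.completeSpace_coe

/-- The isometric embedding `u ↦ (u, ∂ₓu)`. -/
noncomputable def toPair (T : StarNetwork N) : T.H1e →ₗᵢ[ℂ] T.L2Pair :=
  T.h1eSubspace.subtypeₗᵢ

/-- The inclusion `ℍ¹ₑ(T) → 𝕃²(T)`, `u ↦ u`. -/
noncomputable def incl (T : StarNetwork N) : T.H1e →L[ℂ] T.L2 :=
  (WithLp.fstL 2 ℂ T.L2 T.L2).comp T.toPair.toContinuousLinearMap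

/-- The derivative `ℍ¹ₑ(T) → 𝕃²(T)`, `u ↦ ∂ₓu`. -/
noncomputable def dx (T : StarNetwork N) : T.H1e →L[ℂ] T.L2 :=
  (WithLp.sndL 2 ℂ T.L2 T.L2).comp T.toPair.toContinuousLinearMap

/-- The absolutely continuous representative of `uⱼ` on `[0, ℓⱼ]`. -/
noncomputable def rep {T : StarNetwork N} (u : T.H1e) : Fin N → ℝ → ℂ := u.2.choose

theorem rep_zero_eq {T : StarNetwork N} (u : T.H1e) (j : Fin N) :
    rep u j 0 = -EdgeL2.primitive (T.length j) (T.length j) (T.dx u j) := by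
  have h0 : (0 : ℝ) ∈ Set.Icc (0 : ℝ) (T.length j) := ⟨le_rfl, (T.length_pos j).le⟩
  refine ((u.2.choose_spec.1 j).eq_primitive (u.2.choose_spec.2.1 j) h0).trans ?_
  rw [EdgeL2.primitive_apply h0, intervalIntegral.integral_same, zero_sub]
  rfl

/-- The value of `u ∈ ℍ¹ₑ(T)` at the central node, read off on the first edge: `u ↦ u₁(0)`. -/
noncomputable def nodeValue [NeZero N] (T : StarNetwork N) : T.H1e →L[ℂ] ℂ where
  toFun u := rep u 0 0
  map_add' u v := by
    simp only [rep_zero_eq, map_add, PiLp.add_apply]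
    ring
  map_smul' c u := by
    simp only [rep_zero_eq, map_smul, PiLp.smul_apply, RingHom.id_apply, smul_eq_mul]
    ring
  cont := by
    have h : (fun u : T.H1e => rep u 0 0) =
        fun u => -EdgeL2.primitive (T.length 0) (T.length 0)
          (PiLp.proj (𝕜 := ℂ) 2 (fun j : Fin N => EdgeL2 (T.length j)) 0 (T.dx u)) :=
      funext fun u => rep_zero_eq u 0
    change Continuous fun u : T.H1e => rep u 0 0
    rw [h]
    fun_prop

/-- The operator `(I - Δ)⁻¹ : 𝕃²(T) → ℍ¹ₑ(T)` given by the variational formulation: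
`w = (I - Δ)⁻¹ q` is the element of `ℍ¹ₑ(T)` with `⟨w, z⟩_{ℍ¹ₑ} = ⟨q, z⟩_{𝕃²}` for all `z`, i.e. the
solution of `wⱼ - ∂ₓ²wⱼ = qⱼ`, `wⱼ(0) = wₖ(0)`, `∑ⱼ ∂ₓwⱼ(0) = 0`, `wⱼ(ℓⱼ) = 0`. -/
noncomputable def resolvent (T : StarNetwork N) : T.L2 →L[ℂ] T.H1e :=
  ContinuousLinearMap.adjoint T.incl

theorem inner_resolvent (T : StarNetwork N) (q : T.L2) (z : T.H1e) :
    inner ℂ (T.resolvent q) z = inner ℂ q (T.incl z) :=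
  ContinuousLinearMap.adjoint_inner_left _ _ _

/-- The lifting of a flux datum `a` at the central node: the element `g` of `ℍ¹ₑ(T)` with
`⟨g, z⟩_{ℍ¹ₑ} = - ā z(0)` for all `z` (the inner product being conjugate linear in `g`), i.e. the
solution of `gⱼ - ∂ₓ²gⱼ = 0`, `gⱼ(0) = gₖ(0)`, `∑ⱼ ∂ₓgⱼ(0) = a`, `gⱼ(ℓⱼ) = 0`. -/
noncomputable def fluxLift [NeZero N] (T : StarNetwork N) : ℂ →L[ℂ] T.H1e :=
  -ContinuousLinearMap.adjoint T.nodeValue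

theorem inner_fluxLift [NeZero N] (T : StarNetwork N) (a : ℂ) (z : T.H1e) :
    inner ℂ (T.fluxLift a) z = -inner ℂ a (T.nodeValue z) := by
  rw [fluxLift, neg_apply, inner_neg_left,
    ContinuousLinearMap.adjoint_inner_left]

/-- The operator `𝒜` of (LBBM) on `ℍ¹ₑ(T)`: `v = 𝒜 u` is the solution of
`vⱼ - ∂ₓ²vⱼ = - ∂ₓuⱼ`, `vⱼ(0) = vₖ(0)`, `∑ⱼ ∂ₓvⱼ(0) = α u₁(0)`, `vⱼ(ℓⱼ) = 0`. -/
noncomputable def generator [NeZero N] (T : StarNetwork N) (α : ℝ) : T.H1e →L[ℂ] T.H1e :=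
  -(T.resolvent ∘L T.dx) + (α : ℂ) • (T.fluxLift ∘L T.nodeValue)

/-- The semigroup `e^{t𝒜}`. -/
noncomputable def semigroup [NeZero N] (T : StarNetwork N) (α t : ℝ) : T.H1e →L[ℂ] T.H1e :=
  NormedSpace.exp ((t : ℂ) • T.generator α)

/-- The equations of (LBBM) at a fixed time, for `u = u(t, ·)` and `v = ∂ₜu(t, ·)` in `ℍ¹ₑ(T)`.
Here `p j` is the continuous representative on `[0, ℓⱼ]` of `∂ₓvⱼ`, which belongs to `H¹(0, ℓⱼ)`
with weak derivative `q j = ∂ₓ²vⱼ`; the equations are `vⱼ - ∂ₓ²vⱼ + ∂ₓuⱼ = 0` in `L²(0, ℓⱼ)` and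
`∑ⱼ ∂ₓvⱼ(0) = α u₁(0)`. The conditions of continuity at the node and the Dirichlet conditions
are part of the definition of `ℍ¹ₑ(T)`. -/
def SatisfiesLBBM [NeZero N] (T : StarNetwork N) (α : ℝ) (u v : T.H1e) : Prop :=
  ∃ (p : Fin N → ℝ → ℂ) (q : T.L2),
    (∀ j, IsACRep (T.length j) (p j) (T.dx v j) (q j)) ∧
    T.incl v - q + T.dx u = 0 ∧
    ∑ j, p j 0 = α * T.nodeValue u

/-- `u ∈ C([0, ∞), ℍ¹ₑ(T))` is a solution of (LBBM) with initial datum `u₀`. -/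
structure IsLBBMSolution [NeZero N] (T : StarNetwork N) (α : ℝ) (u₀ : T.H1e) (u : ℝ → T.H1e) :
    Prop where
  continuousOn : ContinuousOn u (Set.Ici 0)
  initial : u 0 = u₀
  equation : ∀ t > 0, ∃ v : T.H1e, HasDerivAt u v t ∧ T.SatisfiesLBBM α (u t) v

end StarNetwork

section Semigroup

variable {H : Type*} [NormedAddCommGroup H] [InnerProductSpace ℂ H] [CompleteSpace H]

theorem hasDerivAt_exp_ofReal_smul (A : H →L[ℂ] H) (t : ℝ) :
    HasDerivAt (fun s : ℝ => NormedSpace.exp ((s : ℂ) • A)) (NormedSpace.exp ((t : ℂ) • A) * A) t := by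
  simpa [Function.comp_def] using
    (hasDerivAt_exp_smul_const A (t : ℂ)).scomp t Complex.ofRealCLM.hasDerivAt

theorem hasDerivAt_exp_ofReal_smul' (A : H →L[ℂ] H) (t : ℝ) :
    HasDerivAt (fun s : ℝ => NormedSpace.exp ((s : ℂ) • A)) (A * NormedSpace.exp ((t : ℂ) • A)) t := by
  simpa [Function.comp_def] using
    (hasDerivAt_exp_smul_const' A (t : ℂ)).scomp t Complex.ofRealCLM.hasDerivAt

theorem exp_ofReal_smul_mul_comm (A : H →L[ℂ] H) (t : ℝ) :
    NormedSpace.exp ((t : ℂ) • A) * A = A * NormedSpace.exp ((t : ℂ) • A) :=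
  (hasDerivAt_exp_ofReal_smul A t).unique (hasDerivAt_exp_ofReal_smul' A t)

theorem exp_ofReal_smul_comm_apply (A : H →L[ℂ] H) (t : ℝ) (u : H) :
    NormedSpace.exp ((t : ℂ) • A) (A u) = A (NormedSpace.exp ((t : ℂ) • A) u) :=
  DFunLike.congr_fun (exp_ofReal_smul_mul_comm A t) u

theorem hasDerivAt_exp_ofReal_smul_apply (A : H →L[ℂ] H) (u : H) (t : ℝ) :
    HasDerivAt (fun s : ℝ => NormedSpace.exp ((s : ℂ) • A) u)
      (A (NormedSpace.exp ((t : ℂ) • A) u)) t := by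
  have h := ((ContinuousLinearMap.apply ℂ H u).restrictScalars ℝ).hasFDerivAt.comp_hasDerivAt t
    (hasDerivAt_exp_ofReal_smul' A t)
  exact h

theorem exp_ofReal_smul_zero_apply (A : H →L[ℂ] H) (u : H) :
    NormedSpace.exp (((0 : ℝ) : ℂ) • A) u = u := by
  simp

theorem exp_ofReal_add_smul_apply (A : H →L[ℂ] H) (s t : ℝ) (u : H) :
    NormedSpace.exp (((s + t : ℝ) : ℂ) • A) u =
      NormedSpace.exp ((s : ℂ) • A) (NormedSpace.exp ((t : ℂ) • A) u) := by
  have h : NormedSpace.exp (((s + t : ℝ) : ℂ) • A) =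
      NormedSpace.exp ((s : ℂ) • A) * NormedSpace.exp ((t : ℂ) • A) := by
    rw [Complex.ofReal_add, add_smul]
    let _ := NormedAlgebra.restrictScalars ℚ ℂ (H →L[ℂ] H)
    exact NormedSpace.exp_add_of_commute (((Commute.refl A).smul_left _).smul_right _)
  rw [h]; rfl

/-- A function that is continuous on `[0, ∞)` and solves `u' = A u` on `(0, ∞)` is
`t ↦ exp (t A) (u 0)`. -/
theorem eq_exp_of_hasDerivAt_pos {A : H →L[ℂ] H} {u : ℝ → H} (hc : ContinuousOn u (Set.Ici 0))
    (hd : ∀ t > 0, HasDerivAt u (A (u t)) t) {t : ℝ} (ht : 0 ≤ t) :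
    u t = NormedSpace.exp ((t : ℂ) • A) (u 0) := by
  have hE : ∀ s : ℝ, HasDerivAt (fun s : ℝ => NormedSpace.exp (((-s : ℝ) : ℂ) • A))
      (-(NormedSpace.exp (((-s : ℝ) : ℂ) • A) * A)) s := fun s => by
    simpa [Function.comp_def] using (hasDerivAt_exp_ofReal_smul A (-s)).scomp s (hasDerivAt_neg s)
  have hcont : ContinuousOn (fun s : ℝ => NormedSpace.exp (((-s : ℝ) : ℂ) • A) (u s))
      (Set.Icc 0 t) := by
    have h1 : Continuous (fun s : ℝ => NormedSpace.exp (((-s : ℝ) : ℂ) • A)) :=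
      continuous_iff_continuousAt.2 fun s => (hE s).continuousAt
    exact h1.continuousOn.clm_apply (hc.mono Set.Icc_subset_Ici_self)
  have hder : ∀ s ∈ Set.Ioo 0 t,
      HasDerivAt (fun s : ℝ => NormedSpace.exp (((-s : ℝ) : ℂ) • A) (u s)) 0 s := fun s hs => by
    let B : (H →L[ℂ] H) →L[ℝ] H →L[ℝ] H :=
      (ContinuousLinearMap.restrictScalarsL ℂ H H ℝ ℝ).restrictScalars ℝ
    have h1 : HasDerivAt (fun s : ℝ => B (NormedSpace.exp (((-s : ℝ) : ℂ) • A)))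
        (B (-(NormedSpace.exp (((-s : ℝ) : ℂ) • A) * A))) s :=
      B.hasFDerivAt.comp_hasDerivAt s (hE s)
    have h := h1.clm_apply (hd s hs.1)
    refine h.congr_deriv ?_
    change -(NormedSpace.exp (((-s : ℝ) : ℂ) • A) (A (u s))) +
      NormedSpace.exp (((-s : ℝ) : ℂ) • A) (A (u s)) = 0
    exact neg_add_cancel _
  have key := fun (x : ℝ) (hx : x ∈ Set.Icc 0 t) =>
    constant_of_has_deriv_right_zero (f := fun s : ℝ => NormedSpace.exp (((-s : ℝ) : ℂ) • A) (u s))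
      hcont (fun s hs => by
        rcases hs.1.eq_or_lt with rfl | h0
        · have ht' : (0 : ℝ) < t := hs.2
          refine hasDerivWithinAt_Ici_of_tendsto_deriv (s := Set.Ioo 0 t)
            (fun s hs => (hder s hs).differentiableAt.differentiableWithinAt)
            ((hcont 0 ⟨le_rfl, ht⟩).mono Set.Ioo_subset_Icc_self) (Ioo_mem_nhdsGT ht') ?_
          refine tendsto_const_nhds.congr' ?_
          filter_upwards [Ioo_mem_nhdsGT ht'] with s hs
          exact (hder s hs).deriv.symm
        · exact (hder s ⟨h0, hs.2⟩).hasDerivWithinAt) x hx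
  have h := key t ⟨ht, le_rfl⟩
  simp only [neg_zero] at h
  rw [exp_ofReal_smul_zero_apply] at h
  rw [← h, ← exp_ofReal_add_smul_apply, add_neg_cancel, exp_ofReal_smul_zero_apply]

theorem exp_ofReal_smul_apply_of_eigenvector {A : H →L[ℂ] H} {z : H} {c : ℂ} (h : A z = c • z)
    {t : ℝ} (ht : 0 ≤ t) :
    NormedSpace.exp ((t : ℂ) • A) z = Complex.exp (c * t) • z := by
  have hd : ∀ s : ℝ, HasDerivAt (fun s : ℝ => Complex.exp (c * s) • z)
      (A (Complex.exp (c * s) • z)) s := fun s => by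
    have h1 : HasDerivAt (fun s : ℝ => Complex.exp (c * s)) (Complex.exp (c * s) * (c * 1)) s :=
      (((hasDerivAt_id s).ofReal_comp).const_mul c).cexp
    have h2 := h1.smul_const z
    rw [map_smul, h, smul_smul]
    simpa using h2
  have h0 := eq_exp_of_hasDerivAt_pos (A := A) (u := fun s : ℝ => Complex.exp (c * s) • z)
    (fun s _ => (hd s).continuousAt.continuousWithinAt) (fun s _ => hd s) ht
  simpa using h0.symm

end Semigroup

section Stability

variable {H : Type*} [NormedAddCommGroup H] [InnerProductSpace ℂ H] [CompleteSpace H]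
  {A : H →L[ℂ] H} {ν : H →L[ℂ] ℂ} {β : ℝ}

/-- The states whose free evolution is not seen by the observation `ν` at positive times. -/
noncomputable def unobservableSubspace (A : H →L[ℂ] H) (ν : H →L[ℂ] ℂ) : Submodule ℂ H :=
  ⨅ t : Set.Ioi (0 : ℝ), (ν ∘L NormedSpace.exp (((t : ℝ) : ℂ) • A)).ker

theorem mem_unobservableSubspace {z : H} :
    z ∈ unobservableSubspace A ν ↔ ∀ t : ℝ, 0 < t → ν (NormedSpace.exp ((t : ℂ) • A) z) = 0 := by
  simp [unobservableSubspace, Submodule.mem_iInf]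

theorem isClosed_unobservableSubspace :
    IsClosed (unobservableSubspace A ν : Set H) := by
  rw [unobservableSubspace, Submodule.coe_iInf]
  exact isClosed_iInter fun t => (ν ∘L NormedSpace.exp (((t : ℝ) : ℂ) • A)).isClosed_ker

theorem apply_eq_zero_of_mem_unobservableSubspace {z : H} (hz : z ∈ unobservableSubspace A ν) :
    ν z = 0 := by
  have h1 : Tendsto (fun t : ℝ => ν (NormedSpace.exp ((t : ℂ) • A) z)) (𝓝[>] 0) (𝓝 (ν z)) := by
    have h := (ν.continuous.tendsto _).comp (hasDerivAt_exp_ofReal_smul_apply A z 0).continuousAt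
    simp only [exp_ofReal_smul_zero_apply] at h
    exact h.mono_left nhdsWithin_le_nhds
  refine tendsto_nhds_unique h1 (tendsto_const_nhds.congr' ?_)
  filter_upwards [self_mem_nhdsWithin] with t ht
  exact (mem_unobservableSubspace.1 hz t ht).symm

theorem map_mem_unobservableSubspace {z : H} (hz : z ∈ unobservableSubspace A ν) :
    A z ∈ unobservableSubspace A ν := by
  refine mem_unobservableSubspace.2 fun t ht => ?_
  have h1 : HasDerivAt (fun s : ℝ => ν (NormedSpace.exp ((s : ℂ) • A) z))
      (ν (A (NormedSpace.exp ((t : ℂ) • A) z))) t :=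
    (ν.restrictScalars ℝ).hasFDerivAt.comp_hasDerivAt t (hasDerivAt_exp_ofReal_smul_apply A z t)
  have h2 : HasDerivAt (fun s : ℝ => ν (NormedSpace.exp ((s : ℂ) • A) z)) 0 t := by
    refine (hasDerivAt_const t (0 : ℂ)).congr_of_eventuallyEq ?_
    filter_upwards [lt_mem_nhds ht] with s hs
    exact mem_unobservableSubspace.1 hz s hs
  rw [exp_ofReal_smul_comm_apply]
  exact h1.unique h2

/-- If `A` is compact and skew-symmetric on the kernel of `ν`, and no nonzero element of
that kernel is an eigenvector for a purely imaginary eigenvalue, then the observation determines the state. -/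
theorem unobservableSubspace_eq_bot (hA : IsCompactOperator A)
    (hskew : ∀ z, ν z = 0 → (inner ℂ (A z) z).re = 0)
    (hno : ∀ (μ : ℝ) (z : H), A z = (μ * Complex.I) • z → ν z = 0 → z = 0) :
    unobservableSubspace A ν = ⊥ := by
  set M := unobservableSubspace A ν with hM
  have hcl : IsClosed (M : Set H) := isClosed_unobservableSubspace
  have : CompleteSpace M := hcl.completeSpace_coe
  have hmap : ∀ z ∈ M, ((Complex.I • A : H →L[ℂ] H) : H →ₗ[ℂ] H) z ∈ M := fun z hz =>
    M.smul_mem _ (map_mem_unobservableSubspace hz)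
  let S : M →L[ℂ] M := (Complex.I • A : H →L[ℂ] H).restrict hmap
  have hScoe : ∀ z : M, (S z : H) = Complex.I • A z := fun z => rfl
  have hScomp : IsCompactOperator S :=
    IsCompactOperator.restrict' (f := ((Complex.I • A : H →L[ℂ] H) : H →ₗ[ℂ] H))
      (hA.smul Complex.I) hmap
  have hSsymm : (S : M →ₗ[ℂ] M).IsSymmetric := by
    rw [LinearMap.isSymmetric_iff_inner_map_self_real]
    intro v
    have h0 := hskew v (apply_eq_zero_of_mem_unobservableSubspace v.2)
    rw [Complex.conj_eq_iff_im]
    change (inner ℂ (S v : H) (v : H)).im = 0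
    rw [hScoe, inner_smul_left]
    simp [h0]
  have hS0 : S = 0 := by
    rw [← ContinuousLinearMap.eq_zero_of_forall_hasEigenvalue_eq_zero hScomp hSsymm]
    intro μ hμ
    obtain ⟨v, hv⟩ := hμ.exists_hasEigenvector
    have hreal : (μ.re : ℂ) = μ := by
      have := hSsymm.conj_eigenvalue_eq_self hμ
      exact Complex.conj_eq_iff_re.1 this
    have hv1 : Complex.I • A v = μ • (v : H) := by
      rw [← hScoe]
      exact congrArg Subtype.val hv.apply_eq_smul
    exfalso
    apply hv.2
    refine Subtype.ext (hno (-μ.re) v ?_ (apply_eq_zero_of_mem_unobservableSubspace v.2))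
    have h2 : A v = (-Complex.I) • (Complex.I • A v) := by
      rw [smul_smul]; simp
    rw [h2, hv1, smul_smul]
    congr 1
    push_cast
    rw [hreal]; ring
  rw [eq_bot_iff]
  intro z hz
  have h1 : Complex.I • A z = 0 := by
    have := hScoe ⟨z, hz⟩
    rw [hS0] at this
    exact this.symm
  have h2 : A z = 0 := by simpa using h1
  exact (Submodule.mem_bot ℂ).2
    (hno 0 z (by simp [h2]) (apply_eq_zero_of_mem_unobservableSubspace hz))

theorem hasDerivAt_norm_sq_exp
    (hdiss : ∀ u z, inner ℂ (A u) z + inner ℂ u (A z) = -(2 * β) * inner ℂ (ν u) (ν z))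
    (u : H) (t : ℝ) :
    HasDerivAt (fun s : ℝ => ‖NormedSpace.exp ((s : ℂ) • A) u‖ ^ 2)
      (-(2 * β) * ‖ν (NormedSpace.exp ((t : ℂ) • A) u)‖ ^ 2) t := by
  have h := hasDerivAt_exp_ofReal_smul_apply A u t
  have h1 := h.inner ℂ h
  rw [add_comm, hdiss] at h1
  have h2 := Complex.reCLM.hasFDerivAt.comp_hasDerivAt t h1
  refine (h2.congr_deriv ?_).congr_of_eventuallyEq (Eventually.of_forall fun s => ?_)
  · rw [inner_self_eq_norm_sq_to_K, Complex.reCLM_apply]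
    have h3 : ∀ r : ℝ, (-(2 * (β : ℂ)) * (r : ℂ) ^ 2).re = -(2 * β) * r ^ 2 := fun r => by
      rw [← Complex.ofReal_re (-(2 * β) * r ^ 2)]
      push_cast
      rfl
    exact h3 _
  · exact (inner_self_eq_norm_sq (𝕜 := ℂ) (NormedSpace.exp ((s : ℂ) • A) u)).symm

theorem antitone_norm_exp (hβ : 0 < β)
    (hdiss : ∀ u z, inner ℂ (A u) z + inner ℂ u (A z) = -(2 * β) * inner ℂ (ν u) (ν z)) (u : H) :
    Antitone (fun t : ℝ => ‖NormedSpace.exp ((t : ℂ) • A) u‖) := by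
  have h : Antitone (fun t : ℝ => ‖NormedSpace.exp ((t : ℂ) • A) u‖ ^ 2) :=
    antitone_of_deriv_nonpos
      (fun t => (hasDerivAt_norm_sq_exp hdiss u t).differentiableAt)
      (fun t => by
        rw [(hasDerivAt_norm_sq_exp hdiss u t).deriv]
        nlinarith [sq_nonneg ‖ν (NormedSpace.exp ((t : ℂ) • A) u)‖])
  exact fun s t hst => le_of_sq_le_sq (h hst) (norm_nonneg _)

theorem norm_exp_apply_le (hβ : 0 < β)
    (hdiss : ∀ u z, inner ℂ (A u) z + inner ℂ u (A z) = -(2 * β) * inner ℂ (ν u) (ν z)) (u : H)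
    {t : ℝ} (ht : 0 ≤ t) : ‖NormedSpace.exp ((t : ℂ) • A) u‖ ≤ ‖u‖ := by
  have := antitone_norm_exp hβ hdiss u ht
  simpa only [exp_ofReal_smul_zero_apply] using this

theorem tendsto_norm_exp_apply_map (hβ : 0 < β) (hA : IsCompactOperator A)
    (hdiss : ∀ u z, inner ℂ (A u) z + inner ℂ u (A z) = -(2 * β) * inner ℂ (ν u) (ν z))
    (hM : unobservableSubspace A ν = ⊥) (w : H) :
    Tendsto (fun t : ℝ => ‖NormedSpace.exp ((t : ℂ) • A) (A w)‖) atTop (𝓝 0) := by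
  have hanti := antitone_norm_exp hβ hdiss (A w)
  obtain ⟨c, hc⟩ : ∃ c, Tendsto (fun t : ℝ => ‖NormedSpace.exp ((t : ℂ) • A) (A w)‖) atTop (𝓝 c) :=
    ⟨_, tendsto_atTop_ciInf hanti ⟨0, by rintro _ ⟨t, rfl⟩; exact norm_nonneg _⟩⟩
  have hK := hA.isCompact_closure_image_closedBall (𝕜₁ := ℂ) (f := (A : H →ₗ[ℂ] H)) ‖w‖
  obtain ⟨z, -, φ, hφ, hz⟩ := hK.tendsto_subseq
    (x := fun n : ℕ => NormedSpace.exp (((n : ℝ) : ℂ) • A) (A w)) (fun n => by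
      rw [exp_ofReal_smul_comm_apply]
      exact subset_closure ⟨_, by simpa using norm_exp_apply_le hβ hdiss w n.cast_nonneg, rfl⟩)
  have hnorm : ∀ s : ℝ, ‖NormedSpace.exp ((s : ℂ) • A) z‖ = c := fun s => by
    have h1 := ((NormedSpace.exp ((s : ℂ) • A)).continuous.norm.tendsto z).comp hz
    have h2 : Tendsto (fun n : ℕ => s + ((φ n : ℕ) : ℝ)) atTop atTop :=
      tendsto_atTop_add_const_left _ _ (tendsto_natCast_atTop_atTop.comp hφ.tendsto_atTop)
    refine tendsto_nhds_unique h1 ((hc.comp h2).congr fun n => ?_)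
    simp only [Function.comp_apply]
    rw [exp_ofReal_add_smul_apply]
  have hz0 : z ∈ unobservableSubspace A ν := by
    refine mem_unobservableSubspace.2 fun t _ => ?_
    have h1 := hasDerivAt_norm_sq_exp hdiss z t
    simp only [hnorm] at h1
    have h2 := h1.unique (hasDerivAt_const t (c ^ 2))
    have h3 : ‖ν (NormedSpace.exp ((t : ℂ) • A) z)‖ ^ 2 = 0 := by
      rcases mul_eq_zero.1 h2 with h | h
      · linarith
      · exact h
    simpa using h3
  rw [hM, Submodule.mem_bot] at hz0
  have : c = 0 := by rw [← hnorm 0, hz0]; simp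
  rwa [this] at hc

theorem denseRange_of_dissipative (hβ : 0 < β)
    (hdiss : ∀ u z, inner ℂ (A u) z + inner ℂ u (A z) = -(2 * β) * inner ℂ (ν u) (ν z))
    (hno : ∀ z : H, A z = 0 → ν z = 0 → z = 0) : DenseRange A := by
  have h : (A : H →ₗ[ℂ] H).range.topologicalClosure = ⊤ := by
    rw [Submodule.topologicalClosure_eq_top_iff, eq_bot_iff]
    intro u hu
    have hu' : ∀ z, inner ℂ u (A z) = 0 := fun z =>
      (Submodule.mem_orthogonal' _ _).1 hu _ ⟨z, rfl⟩
    have hν : ν u = 0 := by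
      have h1 := hdiss u u
      rw [hu', ← inner_conj_symm, hu'] at h1
      have h2 : inner ℂ (ν u) (ν u) = 0 := by
        have : (-(2 * (β : ℂ))) ≠ 0 := by simp [hβ.ne']
        simpa [this, hβ.ne'] using h1.symm
      exact inner_self_eq_zero.1 h2
    have hAu : A u = 0 := by
      refine ext_inner_right ℂ fun z => ?_
      have h1 := hdiss u z
      rw [hu', hν] at h1
      simpa using h1
    exact (Submodule.mem_bot ℂ).2 (hno u hAu hν)
  have h2 := (Submodule.dense_iff_topologicalClosure_eq_top).2 h
  rwa [LinearMap.coe_range] at h2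

/-- Strong stability of `exp (t A)` for a compact `A` whose symmetric part is `-β ν* ν`, in the
absence of purely imaginary eigenvalues. -/
theorem tendsto_norm_exp_apply_of_no_eigenvector (hβ : 0 < β) (hA : IsCompactOperator A)
    (hdiss : ∀ u z, inner ℂ (A u) z + inner ℂ u (A z) = -(2 * β) * inner ℂ (ν u) (ν z))
    (hno : ∀ (μ : ℝ) (z : H), A z = (μ * Complex.I) • z → ν z = 0 → z = 0) (u : H) :
    Tendsto (fun t : ℝ => ‖NormedSpace.exp ((t : ℂ) • A) u‖) atTop (𝓝 0) := by
  have hM : unobservableSubspace A ν = ⊥ := by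
    refine unobservableSubspace_eq_bot hA (fun z hz => ?_) hno
    have h := hdiss z z
    rw [hz, ← inner_conj_symm z (A z), Complex.add_conj] at h
    simpa using h
  have hdense : DenseRange A :=
    denseRange_of_dissipative hβ hdiss fun z hz hν => hno 0 z (by simp [hz]) hν
  rw [Metric.tendsto_atTop]
  intro ε hε
  obtain ⟨w, hw⟩ := hdense.exists_dist_lt u (half_pos hε)
  obtain ⟨t₀, ht₀⟩ := Metric.tendsto_atTop.1 (tendsto_norm_exp_apply_map hβ hA hdiss hM w) (ε / 2)
    (half_pos hε)
  refine ⟨max t₀ 0, fun t ht => ?_⟩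
  have h1 := ht₀ t ((le_max_left _ _).trans ht)
  have h2 := norm_exp_apply_le hβ hdiss (u - A w) ((le_max_right _ _).trans ht)
  rw [dist_eq_norm] at hw
  simp only [Real.dist_eq, sub_zero, abs_norm] at h1 ⊢
  calc ‖NormedSpace.exp ((t : ℂ) • A) u‖
      = ‖NormedSpace.exp ((t : ℂ) • A) (u - A w) + NormedSpace.exp ((t : ℂ) • A) (A w)‖ := by
        rw [← map_add, sub_add_cancel]
    _ ≤ _ := norm_add_le _ _
    _ < ε := by linarith

end Stability

section Edge

variable {L : ℝ}

theorem IsACRep.continuousOn {f : ℝ → ℂ} {v dv : EdgeL2 L} (hL : 0 ≤ L) (hf : IsACRep L f v dv) :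
    ContinuousOn f (Set.Icc 0 L) := by
  have h : ContinuousOn (fun x => f 0 + ∫ s in (0 : ℝ)..x, dv s) (Set.Icc 0 L) := by
    refine continuousOn_const.add ?_
    have := intervalIntegral.continuousOn_primitive_interval'
      (EdgeL2.intervalIntegrable dv (Set.right_mem_Icc.2 hL)) (Set.left_mem_uIcc)
    rwa [Set.uIcc_of_le hL] at this
  exact h.congr hf.2

/-- Two functions that are continuous on `[0, L]` and agree almost everywhere agree on `[0, L]`. -/
theorem eqOn_Icc_of_ae_eq {f g : ℝ → ℂ} (hL : 0 < L) (hf : ContinuousOn f (Set.Icc 0 L))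
    (hg : ContinuousOn g (Set.Icc 0 L)) (h : f =ᵐ[volume.restrict (Set.Ioc (0 : ℝ) L)] g) :
    Set.EqOn f g (Set.Icc 0 L) := by
  rw [← restrict_Ioo_eq_restrict_Ioc] at h
  have h1 : Set.EqOn f g (Set.Ioo 0 L) :=
    Measure.eqOn_open_of_ae_eq h isOpen_Ioo (hf.mono Set.Ioo_subset_Icc_self)
      (hg.mono Set.Ioo_subset_Icc_self)
  refine h1.of_subset_closure hf hg Set.Ioo_subset_Icc_self ?_
  rw [closure_Ioo hL.ne]

theorem IsACRep.eqOn {f g : ℝ → ℂ} {v dv dw : EdgeL2 L} (hL : 0 < L) (hf : IsACRep L f v dv)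
    (hg : IsACRep L g v dw) : Set.EqOn f g (Set.Icc 0 L) := by
  refine eqOn_Icc_of_ae_eq hL (hf.continuousOn hL.le) (hg.continuousOn hL.le) ?_
  filter_upwards [hf.1, hg.1] with x h1 h2
  rw [← h1, h2]

theorem eq_zero_of_primitive_eq_zero (g : EdgeL2 L) (hL : 0 < L)
    (h : ∀ x ∈ Set.Icc (0 : ℝ) L, ∫ s in (0 : ℝ)..x, g s = 0) : g = 0 := by
  have hi := EdgeL2.intervalIntegrable g (Set.right_mem_Icc.2 hL.le)
  have h1 := hi.ae_hasDerivAt_integral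
  rw [Lp.eq_zero_iff_ae_eq_zero]
  have key : g =ᵐ[volume.restrict (Set.Ioo (0 : ℝ) L)] 0 := ?_
  · rwa [restrict_Ioo_eq_restrict_Ioc] at key
  filter_upwards [ae_restrict_of_ae h1, ae_restrict_mem measurableSet_Ioo] with x hx hm
  have h2 := hx (by rw [Set.uIcc_of_le hL.le]; exact Set.Ioo_subset_Icc_self hm) 0 Set.left_mem_uIcc
  have h3 : HasDerivAt (fun x => ∫ s in (0 : ℝ)..x, g s) 0 x := by
    refine (hasDerivAt_const x (0 : ℂ)).congr_of_eventuallyEq ?_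
    filter_upwards [isOpen_Ioo.mem_nhds hm] with y hy
    exact h y (Set.Ioo_subset_Icc_self hy)
  exact h2.unique h3

theorem integral_mul_primitive_add {a b : ℝ → ℂ}
    (ha : IntegrableOn a (Set.Ioc 0 L)) (hb : IntegrableOn b (Set.Ioc 0 L)) :
    (∫ s in Set.Ioc 0 L, a s * ∫ t in (0 : ℝ)..s, b t) +
      ∫ t in Set.Ioc 0 L, (∫ s in (0 : ℝ)..t, a s) * b t =
      (∫ s in Set.Ioc 0 L, a s) * ∫ t in Set.Ioc 0 L, b t := by
  set μ := volume.restrict (Set.Ioc (0 : ℝ) L) with hμ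
  have hS : MeasurableSet {p : ℝ × ℝ | p.2 ≤ p.1} := measurableSet_le measurable_snd measurable_fst
  have hF : Integrable (fun p : ℝ × ℝ => a p.1 * b p.2) (μ.prod μ) := Integrable.mul_prod ha hb
  rw [← integral_prod_mul, ← integral_add_compl hS hF, ← integral_indicator hS,
    ← integral_indicator hS.compl, integral_prod _ (hF.indicator hS),
    integral_prod_symm _ (hF.indicator hS.compl)]
  congr 1
  · refine setIntegral_congr_fun measurableSet_Ioc fun s hs => ?_
    have h1 : ∀ t, {p : ℝ × ℝ | p.2 ≤ p.1}.indicator (fun p : ℝ × ℝ => a p.1 * b p.2) (s, t) =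
        (Set.Iic s).indicator (fun t => a s * b t) t := fun t => by
      simp [Set.indicator_apply]
    simp only [h1]
    rw [integral_indicator measurableSet_Iic, integral_const_mul, hμ,
      Measure.restrict_restrict measurableSet_Iic, intervalIntegral.integral_of_le hs.1.le]
    congr 3
    ext t; simp only [Set.mem_inter_iff, Set.mem_Iic, Set.mem_Ioc]
    exact ⟨fun h => ⟨h.2, h.1, h.2.trans hs.2⟩, fun h => ⟨h.2.1, h.1⟩⟩
  · refine setIntegral_congr_fun measurableSet_Ioc fun t ht => ?_
    have h1 : ∀ s, {p : ℝ × ℝ | p.2 ≤ p.1}ᶜ.indicator (fun p : ℝ × ℝ => a p.1 * b p.2) (s, t) =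
        (Set.Iio t).indicator (fun s => a s * b t) s := fun s => by
      simp [Set.indicator_apply]
    simp only [h1]
    rw [integral_indicator measurableSet_Iio, integral_mul_const, hμ,
      Measure.restrict_restrict measurableSet_Iio, intervalIntegral.integral_of_le ht.1.le,
      integral_Ioc_eq_integral_Ioo]
    congr 3
    ext s; simp only [Set.mem_inter_iff, Set.mem_Iio, Set.mem_Ioc, Set.mem_Ioo]
    exact ⟨fun h => ⟨h.2, h.1, h.2.le.trans ht.2⟩, fun h => ⟨h.2.1, h.1⟩⟩

/-- Integration by parts on an edge. -/
theorem IsACRep.inner_add_inner {f g : ℝ → ℂ} {v dv w dw : EdgeL2 L} (hL : 0 ≤ L)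
    (hf : IsACRep L f v dv) (hg : IsACRep L g w dw) :
    inner ℂ dv w + inner ℂ v dw = starRingEnd ℂ (f L) * g L - starRingEnd ℂ (f 0) * g 0 := by
  have hdv : Integrable dv (volume.restrict (Set.Ioc (0 : ℝ) L)) :=
    (Lp.memLp dv).integrable (by norm_num)
  have hdw : Integrable dw (volume.restrict (Set.Ioc (0 : ℝ) L)) :=
    (Lp.memLp dw).integrable (by norm_num)
  have hdv' : Integrable (fun x => starRingEnd ℂ (dv x)) (volume.restrict (Set.Ioc (0 : ℝ) L)) :=
    Complex.conjCLE.toContinuousLinearMap.integrable_comp hdv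
  have hLL := Set.right_mem_Icc.2 hL
  have hprod := integral_mul_primitive_add hdv' hdw
  have hconj : ∀ t, ∫ s in (0 : ℝ)..t, starRingEnd ℂ (dv s) =
      starRingEnd ℂ (∫ s in (0 : ℝ)..t, dv s) := fun t => by
    exact intervalIntegral.intervalIntegral_conj
  have hI1 := L2.integrable_inner (𝕜 := ℂ) dv w
  have hI2 := L2.integrable_inner (𝕜 := ℂ) v dw
  have e1 : (fun x => inner ℂ (dv x) (w x)) =ᵐ[volume.restrict (Set.Ioc (0 : ℝ) L)]
      fun x => starRingEnd ℂ (dv x) * g 0 + starRingEnd ℂ (dv x) * ∫ t in (0 : ℝ)..x, dw t := by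
    filter_upwards [hg.1, ae_restrict_mem measurableSet_Ioc] with x h1 hm
    rw [h1, hg.2 x (Set.Ioc_subset_Icc_self hm), RCLike.inner_apply]
    ring
  have e2 : (fun x => inner ℂ (v x) (dw x)) =ᵐ[volume.restrict (Set.Ioc (0 : ℝ) L)]
      fun x => starRingEnd ℂ (f 0) * dw x + (∫ s in (0 : ℝ)..x, starRingEnd ℂ (dv s)) * dw x := by
    filter_upwards [hf.1, ae_restrict_mem measurableSet_Ioc] with x h1 hm
    rw [h1, hf.2 x (Set.Ioc_subset_Icc_self hm), RCLike.inner_apply, hconj, map_add]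
    ring
  have i1 := hdv'.mul_const (g 0)
  have i2 := hdw.const_mul (starRingEnd ℂ (f 0))
  have j1 : Integrable (fun x => starRingEnd ℂ (dv x) * ∫ t in (0 : ℝ)..x, dw t)
      (volume.restrict (Set.Ioc (0 : ℝ) L)) := by
    refine ((hI1.congr e1).sub i1).congr (Eventually.of_forall fun x => ?_)
    simp
  have j2 : Integrable (fun x => (∫ s in (0 : ℝ)..x, starRingEnd ℂ (dv s)) * dw x)
      (volume.restrict (Set.Ioc (0 : ℝ) L)) := by
    refine ((hI2.congr e2).sub i2).congr (Eventually.of_forall fun x => ?_)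
    simp
  rw [L2.inner_def, L2.inner_def, integral_congr_ae e1, integral_congr_ae e2,
    integral_add i1 j1, integral_add i2 j2, integral_mul_const, integral_const_mul, hf.2 L hLL,
    hg.2 L hLL, map_add, ← hconj, intervalIntegral.integral_of_le hL,
    intervalIntegral.integral_of_le hL]
  linear_combination hprod

/-- The constant function `c` in `L²(0, L)`. -/
noncomputable def EdgeL2.const (L : ℝ) (c : ℂ) : EdgeL2 L :=
  Lp.const 2 (volume.restrict (Set.Ioc (0 : ℝ) L)) c

theorem EdgeL2.const_ae (L : ℝ) (c : ℂ) :
    EdgeL2.const L c =ᵐ[volume.restrict (Set.Ioc (0 : ℝ) L)] fun _ => c :=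
  Lp.coeFn_const ..

theorem EdgeL2.inner_const_left (hL : 0 ≤ L) (c : ℂ) (g : EdgeL2 L) :
    inner ℂ (EdgeL2.const L c) g = starRingEnd ℂ c * EdgeL2.primitive L L g := by
  have e : (fun x => inner ℂ (EdgeL2.const L c x) (g x))
      =ᵐ[volume.restrict (Set.Ioc (0 : ℝ) L)] fun x => starRingEnd ℂ c * g x := by
    filter_upwards [EdgeL2.const_ae L c] with x hx
    rw [hx, RCLike.inner_apply, mul_comm]
  rw [L2.inner_def, integral_congr_ae e, integral_const_mul,
    EdgeL2.primitive_apply (Set.right_mem_Icc.2 hL), intervalIntegral.integral_of_le hL]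

theorem EdgeL2.primitive_const {x : ℝ} (hx : x ∈ Set.Icc 0 L) (c : ℂ) :
    EdgeL2.primitive L x (EdgeL2.const L c) = x * c := by
  rw [EdgeL2.primitive_apply hx, EdgeL2.integral_congr (EdgeL2.const_ae L c) hx]
  simp

theorem EdgeL2.norm_primitive_sub_le {x y : ℝ} (hx : x ∈ Set.Icc 0 L) (hy : y ∈ Set.Icc 0 L)
    (hxy : x ≤ y) (g : EdgeL2 L) :
    ‖EdgeL2.primitive L y g - EdgeL2.primitive L x g‖ ≤ Real.sqrt (y - x) * ‖g‖ := by
  have hsub : Set.Ioc x y ⊆ Set.Ioc 0 L := Set.Ioc_subset_Ioc hx.1 hy.2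
  have hfin : volume.restrict (Set.Ioc (0 : ℝ) L) (Set.Ioc x y) ≠ ⊤ := measure_ne_top _ _
  have h1 : EdgeL2.primitive L y g - EdgeL2.primitive L x g =
      inner ℂ (indicatorConstLp 2 (measurableSet_Ioc (a := x) (b := y)) hfin (1 : ℂ)) g := by
    rw [L2.inner_indicatorConstLp_one, EdgeL2.primitive_apply hx, EdgeL2.primitive_apply hy,
      intervalIntegral.integral_interval_sub_left (EdgeL2.intervalIntegrable g hy)
        (EdgeL2.intervalIntegrable g hx), intervalIntegral.integral_of_le hxy,
      Measure.restrict_restrict measurableSet_Ioc, Set.inter_eq_left.2 hsub]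
  rw [h1]
  refine (norm_inner_le_norm _ _).trans (mul_le_mul_of_nonneg_right ?_ (norm_nonneg _))
  rw [norm_indicatorConstLp (by norm_num) (by norm_num)]
  simp [Measure.real, Measure.restrict_apply measurableSet_Ioc, Set.inter_eq_left.2 hsub,
    Real.sqrt_eq_rpow, ENNReal.toReal_ofReal (sub_nonneg.2 hxy)]

theorem EdgeL2.continuousOn_primitive (hL : 0 ≤ L) (g : EdgeL2 L) :
    ContinuousOn (fun x => EdgeL2.primitive L x g) (Set.Icc 0 L) := by
  have := intervalIntegral.continuousOn_primitive_interval'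
    (EdgeL2.intervalIntegrable g (Set.right_mem_Icc.2 hL)) (Set.left_mem_uIcc)
  rw [Set.uIcc_of_le hL] at this
  exact this.congr fun x hx => EdgeL2.primitive_apply hx g

end Edge

section Compact

variable {L : ℝ}

/-- The step function approximation, on a grid of `n` cells, of the primitive vanishing at `L`. -/
noncomputable def EdgeL2.stepPrimitive (L : ℝ) (n : ℕ) : EdgeL2 L →L[ℂ] EdgeL2 L :=
  ∑ k ∈ Finset.range n, (EdgeL2.primitive L (k * (L / n)) - EdgeL2.primitive L L).smulRight
    (indicatorConstLp (μ := volume.restrict (Set.Ioc (0 : ℝ) L)) 2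
      (measurableSet_Ioc (a := k * (L / n)) (b := (k + 1) * (L / n))) (measure_ne_top _ _) (1 : ℂ))

theorem EdgeL2.isCompactOperator_stepPrimitive (L : ℝ) (n : ℕ) :
    IsCompactOperator (EdgeL2.stepPrimitive L n) := by
  have h : EdgeL2.stepPrimitive L n ∈ compactOperator (RingHom.id ℂ) (EdgeL2 L) (EdgeL2 L) := by
    refine Submodule.sum_mem _ fun k _ => ?_
    exact (isCompactOperator_of_locallyCompactSpace_rng
      (ContinuousLinearMap.toSpanSingleton ℂ (indicatorConstLp
        (μ := volume.restrict (Set.Ioc (0 : ℝ) L)) 2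
        (measurableSet_Ioc (a := k * (L / n)) (b := (k + 1) * (L / n)))
        (measure_ne_top _ _) (1 : ℂ)))).comp_clm
      (EdgeL2.primitive L (k * (L / n)) - EdgeL2.primitive L L)
  exact h

theorem EdgeL2.stepPrimitive_ae (n : ℕ) (g : EdgeL2 L) :
    ∀ᵐ x ∂(volume.restrict (Set.Ioc (0 : ℝ) L)), EdgeL2.stepPrimitive L n g x =
      ∑ k ∈ Finset.range n, (EdgeL2.primitive L (k * (L / n)) g - EdgeL2.primitive L L g) *
        (Set.Ioc (k * (L / n)) ((k + 1) * (L / n))).indicator (fun _ => 1) x := by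
  have h1 : EdgeL2.stepPrimitive L n g = ∑ k ∈ Finset.range n,
      (EdgeL2.primitive L (k * (L / n)) g - EdgeL2.primitive L L g) •
      (indicatorConstLp (μ := volume.restrict (Set.Ioc (0 : ℝ) L)) 2
        (measurableSet_Ioc (a := k * (L / n)) (b := (k + 1) * (L / n))) (measure_ne_top _ _)
        (1 : ℂ)) := by
    simp [EdgeL2.stepPrimitive]
  have h2 : ∀ᵐ x ∂(volume.restrict (Set.Ioc (0 : ℝ) L)), ∀ k : ℕ,
      ((EdgeL2.primitive L (k * (L / n)) g - EdgeL2.primitive L L g) •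
      (indicatorConstLp (μ := volume.restrict (Set.Ioc (0 : ℝ) L)) 2
        (measurableSet_Ioc (a := k * (L / n)) (b := (k + 1) * (L / n))) (measure_ne_top _ _)
        (1 : ℂ)) : EdgeL2 L) x =
      (EdgeL2.primitive L (k * (L / n)) g - EdgeL2.primitive L L g) *
        (Set.Ioc (k * (L / n)) ((k + 1) * (L / n))).indicator (fun _ => 1) x := by
    refine ae_all_iff.2 fun k => ?_
    filter_upwards [Lp.coeFn_smul (EdgeL2.primitive L (k * (L / n)) g - EdgeL2.primitive L L g)
      (indicatorConstLp (μ := volume.restrict (Set.Ioc (0 : ℝ) L)) 2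
        (measurableSet_Ioc (a := k * (L / n)) (b := (k + 1) * (L / n))) (measure_ne_top _ _)
        (1 : ℂ)), indicatorConstLp_coeFn (μ := volume.restrict (Set.Ioc (0 : ℝ) L)) (p := 2)
        (hs := measurableSet_Ioc (a := k * (L / n)) (b := (k + 1) * (L / n)))
        (hμs := measure_ne_top _ _) (c := (1 : ℂ))] with x hx1 hx2
    rw [hx1, Pi.smul_apply, hx2, smul_eq_mul]
  rw [h1]
  filter_upwards [Lp.coeFn_finsetSum (Finset.range n) fun k : ℕ =>
      ((EdgeL2.primitive L (k * (L / n)) g - EdgeL2.primitive L L g) •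
      (indicatorConstLp (μ := volume.restrict (Set.Ioc (0 : ℝ) L)) 2
        (measurableSet_Ioc (a := k * (L / n)) (b := (k + 1) * (L / n))) (measure_ne_top _ _)
        (1 : ℂ)) : EdgeL2 L), h2] with x hx hx2
  rw [hx, Finset.sum_apply]
  exact Finset.sum_congr rfl fun k _ => hx2 k

theorem IsACRep.norm_sub_stepPrimitive_le {f : ℝ → ℂ} {v dv : EdgeL2 L} (hL : 0 < L)
    (hf : IsACRep L f v dv) (h : f L = 0) {n : ℕ} (hn : 0 < n) :
    ‖v - EdgeL2.stepPrimitive L n dv‖ ≤ Real.sqrt L * (Real.sqrt (L / n) * ‖dv‖) := by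
  have hn' : (0 : ℝ) < n := Nat.cast_pos.2 hn
  have hd : 0 < L / n := div_pos hL hn'
  have key : ∀ᵐ x ∂(volume.restrict (Set.Ioc (0 : ℝ) L)),
      ‖(v - EdgeL2.stepPrimitive L n dv) x‖ ≤ Real.sqrt (L / n) * ‖dv‖ := by
    filter_upwards [hf.1, EdgeL2.stepPrimitive_ae n dv, Lp.coeFn_sub v (EdgeL2.stepPrimitive L n dv),
      ae_restrict_mem measurableSet_Ioc] with x h1 h2 h3 hx
    obtain ⟨k, hk⟩ : ∃ k : ℕ, ⌈x / (L / n)⌉₊ = k + 1 :=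
      Nat.exists_eq_succ_of_ne_zero (Nat.ceil_pos.2 (div_pos hx.1 hd)).ne'
    have hk1 : (k : ℝ) * (L / n) < x := by
      have : k < ⌈x / (L / n)⌉₊ := by omega
      rwa [Nat.lt_ceil, lt_div_iff₀ hd] at this
    have hk2 : x ≤ ((k : ℝ) + 1) * (L / n) := by
      have := Nat.le_ceil (x / (L / n))
      rw [hk, div_le_iff₀ hd] at this
      exact_mod_cast this
    have hkn : k < n := by
      have h4 : (k : ℝ) * (L / n) < n * (L / n) := by
        rw [mul_div_cancel₀ L hn'.ne']; exact hk1.trans_le hx.2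
      exact_mod_cast lt_of_mul_lt_mul_right h4 hd.le
    have hk0 : (k : ℝ) * (L / n) ∈ Set.Icc 0 L := ⟨by positivity, (hk1.le).trans hx.2⟩
    have hxI := Set.Ioc_subset_Icc_self hx
    rw [h3, Pi.sub_apply, h1, h2, Finset.sum_eq_single_of_mem k (Finset.mem_range.2 hkn),
      Set.indicator_of_mem (Set.mem_Ioc.2 ⟨hk1, hk2⟩), mul_one, hf.eq_primitive h hxI,
      sub_sub_sub_cancel_right]
    · refine (EdgeL2.norm_primitive_sub_le hk0 hxI hk1.le dv).trans
        (mul_le_mul_of_nonneg_right (Real.sqrt_le_sqrt ?_) (norm_nonneg _))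
      linarith
    · intro m _ hm
      rw [Set.indicator_of_notMem, mul_zero]
      rintro ⟨hm1, hm2⟩
      apply hm
      have h5 : (m : ℝ) < k + 1 := lt_of_mul_lt_mul_right (hm1.trans_le hk2) hd.le
      have h6 : (k : ℝ) < m + 1 := lt_of_mul_lt_mul_right (hk1.trans_le hm2) hd.le
      have h7 : m < k + 1 := by exact_mod_cast h5
      have h8 : k < m + 1 := by exact_mod_cast h6
      omega
  refine (Lp.norm_le_of_ae_bound (by positivity) key).trans (le_of_eq ?_)
  simp [measureUnivNNReal, Real.sqrt_eq_rpow, hL.le, ENNReal.ofReal]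

end Compact

namespace StarNetwork

variable {N : ℕ} {T : StarNetwork N}

theorem rep_spec (u : T.H1e) (j : Fin N) :
    IsACRep (T.length j) (rep u j) (T.incl u j) (T.dx u j) :=
  u.2.choose_spec.1 j

theorem rep_length (u : T.H1e) (j : Fin N) : rep u j (T.length j) = 0 :=
  u.2.choose_spec.2.1 j

theorem rep_zero [NeZero N] (u : T.H1e) (j : Fin N) : rep u j 0 = T.nodeValue u :=
  u.2.choose_spec.2.2 j 0

theorem inner_eq (u z : T.H1e) :
    inner ℂ u z = inner ℂ (T.incl u) (T.incl z) + inner ℂ (T.dx u) (T.dx z) := by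
  rw [← T.toPair.inner_map_map]
  rfl

theorem ext_incl_dx {u z : T.H1e} (h1 : T.incl u = T.incl z) (h2 : T.dx u = T.dx z) : u = z := by
  refine T.toPair.injective ?_
  exact WithLp.ofLp_injective 2 (Prod.ext h1 h2)

/-- The element of `ℍ¹ₑ(T)` with prescribed absolutely continuous representatives. -/
def ofIsACRep (f : Fin N → ℝ → ℂ) (v dv : T.L2) (h : ∀ j, IsACRep (T.length j) (f j) (v j) (dv j))
    (hl : ∀ j, f j (T.length j) = 0) (h0 : ∀ j k, f j 0 = f k 0) : T.H1e :=
  ⟨WithLp.toLp 2 (v, dv), f, h, hl, h0⟩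

section ofIsACRep

variable {f : Fin N → ℝ → ℂ} {v dv : T.L2} (h : ∀ j, IsACRep (T.length j) (f j) (v j) (dv j))
    (hl : ∀ j, f j (T.length j) = 0) (h0 : ∀ j k, f j 0 = f k 0)

theorem rep_ofIsACRep (j : Fin N) :
    Set.EqOn (rep (ofIsACRep f v dv h hl h0) j) (f j) (Set.Icc 0 (T.length j)) :=
  (rep_spec (ofIsACRep f v dv h hl h0) j).eqOn (T.length_pos j) (h j)

end ofIsACRep

theorem isCompactOperator_incl (T : StarNetwork N) : IsCompactOperator T.incl := by
  have h1 : ∀ j, IsCompactOperator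
      ((PiLp.proj (𝕜 := ℂ) 2 (fun j : Fin N => EdgeL2 (T.length j)) j).comp T.incl) := fun j => by
    set I := (PiLp.proj (𝕜 := ℂ) 2 (fun j : Fin N => EdgeL2 (T.length j)) j).comp T.incl
    set D := (PiLp.proj (𝕜 := ℂ) 2 (fun j : Fin N => EdgeL2 (T.length j)) j).comp T.dx
    refine isCompactOperator_of_tendsto (l := atTop)
      (F := fun n : ℕ => (EdgeL2.stepPrimitive (T.length j) n).comp D) (f := I) ?_
      (Eventually.of_forall fun n =>
        (EdgeL2.isCompactOperator_stepPrimitive (T.length j) n).comp_clm D)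
    rw [tendsto_iff_norm_sub_tendsto_zero]
    have hlim : Tendsto (fun n : ℕ => Real.sqrt (T.length j) *
        (Real.sqrt (T.length j / n) * ‖D‖)) atTop (𝓝 0) := by
      have h2 := (Real.continuous_sqrt.tendsto 0).comp (tendsto_const_div_atTop_nhds_zero_nat (T.length j))
      rw [Real.sqrt_zero] at h2
      simpa using (h2.mul_const ‖D‖).const_mul (Real.sqrt (T.length j))
    refine squeeze_zero' (Eventually.of_forall fun n => norm_nonneg _) ?_ hlim
    filter_upwards [eventually_gt_atTop 0] with n hn
    refine ContinuousLinearMap.opNorm_le_bound _ (by positivity) fun u => ?_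
    have h3 := (rep_spec u j).norm_sub_stepPrimitive_le (T.length_pos j) (rep_length u j) hn
    rw [norm_sub_rev] at h3
    refine h3.trans ?_
    rw [mul_assoc, mul_assoc]
    gcongr
    exact D.le_opNorm u
  have h2 : T.incl = ∑ j, ((PiLp.continuousLinearEquiv 2 ℂ
      (fun j : Fin N => EdgeL2 (T.length j))).symm.toContinuousLinearMap.comp
      (ContinuousLinearMap.single ℂ (fun j : Fin N => EdgeL2 (T.length j)) j)).comp
      ((PiLp.proj (𝕜 := ℂ) 2 (fun j : Fin N => EdgeL2 (T.length j)) j).comp T.incl) := by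
    ext u : 1
    refine PiLp.ext fun k => ?_
    rw [sum_apply, WithLp.ofLp_sum, Finset.sum_apply]
    rw [Finset.sum_eq_single_of_mem k (Finset.mem_univ k)]
    · exact (Pi.single_eq_same (M := fun j : Fin N => EdgeL2 (T.length j)) k (T.incl u k)).symm
    · intro j _ hj
      exact Pi.single_eq_of_ne (M := fun j : Fin N => EdgeL2 (T.length j)) hj.symm (T.incl u j)
  have h3 : T.incl ∈ compactOperator (RingHom.id ℂ) T.H1e T.L2 := by
    rw [h2]
    exact Submodule.sum_mem _ fun j _ => (h1 j).clm_comp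
      ((PiLp.continuousLinearEquiv 2 ℂ
        (fun j : Fin N => EdgeL2 (T.length j))).symm.toContinuousLinearMap.comp
        (ContinuousLinearMap.single ℂ (fun j : Fin N => EdgeL2 (T.length j)) j))
  exact h3

variable [NeZero N]

theorem inner_dx_incl_add (u z : T.H1e) :
    inner ℂ (T.dx u) (T.incl z) + inner ℂ (T.incl u) (T.dx z) =
      -N * inner ℂ (T.nodeValue u) (T.nodeValue z) := by
  rw [PiLp.inner_apply, PiLp.inner_apply, ← Finset.sum_add_distrib]
  have h : ∀ j ∈ Finset.univ, inner ℂ (T.dx u j) (T.incl z j) + inner ℂ (T.incl u j) (T.dx z j) =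
      -inner ℂ (T.nodeValue u) (T.nodeValue z) := fun j _ => by
    rw [(rep_spec u j).inner_add_inner (T.length_pos j).le (rep_spec z j), rep_length, rep_zero,
      rep_length, rep_zero, RCLike.inner_apply]
    simp [mul_comm]
  rw [Finset.sum_congr rfl h]
  simp

theorem inner_generator (α : ℝ) (u z : T.H1e) :
    inner ℂ (T.generator α u) z =
      -inner ℂ (T.dx u) (T.incl z) - α * inner ℂ (T.nodeValue u) (T.nodeValue z) := by
  have h : T.generator α u = -(T.resolvent (T.dx u)) + (α : ℂ) • T.fluxLift (T.nodeValue u) := rfl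
  rw [h, inner_add_left, inner_neg_left, inner_smul_left, inner_resolvent, inner_fluxLift,
    Complex.conj_ofReal]
  ring

theorem inner_generator_add (α : ℝ) (u z : T.H1e) :
    inner ℂ (T.generator α u) z + inner ℂ u (T.generator α z) =
      -(2 * ((α - N / 2 : ℝ) : ℂ)) * inner ℂ (T.nodeValue u) (T.nodeValue z) := by
  rw [← inner_conj_symm u, inner_generator, inner_generator]
  simp only [map_sub, map_neg, map_mul, inner_conj_symm, Complex.conj_ofReal]
  have h := inner_dx_incl_add u z
  push_cast
  linear_combination -h

theorem generator_eq (T : StarNetwork N) (α : ℝ) : T.generator α =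
    ContinuousLinearMap.adjoint T.dx ∘L T.incl +
      ((N - α : ℝ) : ℂ) • (ContinuousLinearMap.adjoint T.nodeValue ∘L T.nodeValue) := by
  refine ContinuousLinearMap.ext fun u => ext_inner_right ℂ fun z => ?_
  rw [inner_generator]
  simp only [add_apply, smul_apply, ContinuousLinearMap.comp_apply, inner_add_left, inner_smul_left,
    ContinuousLinearMap.adjoint_inner_left, Complex.conj_ofReal]
  have h := inner_dx_incl_add u z
  push_cast
  linear_combination -h

theorem isCompactOperator_generator (T : StarNetwork N) (α : ℝ) :
    IsCompactOperator (T.generator α) := by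
  rw [generator_eq]
  refine IsCompactOperator.add 
    (f := (ContinuousLinearMap.adjoint T.dx ∘L T.incl))
    (g := (((N - α : ℝ) : ℂ) • (ContinuousLinearMap.adjoint T.nodeValue ∘L T.nodeValue) :
      T.H1e →L[ℂ] T.H1e))
    (T.isCompactOperator_incl.clm_comp (ContinuousLinearMap.adjoint T.dx)) ?_
  refine IsCompactOperator.smul
    (f := (ContinuousLinearMap.adjoint T.nodeValue ∘L T.nodeValue)) ?_ ((N - α : ℝ) : ℂ)
  exact (isCompactOperator_of_locallyCompactSpace_rng
    (ContinuousLinearMap.adjoint T.nodeValue)).comp_clm T.nodeValue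

end StarNetwork

section Edge

variable {L : ℝ}

theorem EdgeL2.exists_isACRep (hL : 0 ≤ L) (g : EdgeL2 L) (c : ℂ) :
    ∃ w : EdgeL2 L, IsACRep L (fun x => c + ∫ s in (0 : ℝ)..x, g s) w g := by
  have hc : ContinuousOn (fun x => c + ∫ s in (0 : ℝ)..x, g s) (Set.Icc 0 L) :=
    continuousOn_const.add ((EdgeL2.continuousOn_primitive hL g).congr fun x hx =>
      (EdgeL2.primitive_apply hx g).symm)
  obtain ⟨C, hC⟩ := isCompact_Icc.exists_bound_of_continuousOn hc
  have hm : MemLp (fun x => c + ∫ s in (0 : ℝ)..x, g s) 2 (volume.restrict (Set.Ioc (0 : ℝ) L)) := by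
    refine MemLp.of_bound ((hc.mono Set.Ioc_subset_Icc_self).aestronglyMeasurable
      measurableSet_Ioc) C ?_
    filter_upwards [ae_restrict_mem measurableSet_Ioc] with x hx
    exact hC x (Set.Ioc_subset_Icc_self hx)
  exact ⟨hm.toLp, hm.coeFn_toLp, fun x _ => by simp⟩

theorem IsACRep.const (L : ℝ) (c : ℂ) : IsACRep L (fun _ => c) (EdgeL2.const L c) 0 := by
  refine ⟨EdgeL2.const_ae L c, fun x hx => ?_⟩
  rw [EdgeL2.integral_congr (Lp.coeFn_zero _ _ _) hx]
  simp

end Edge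

namespace StarNetwork

variable {N : ℕ} [NeZero N] {T : StarNetwork N}

theorem exists_dx_eq {g : T.L2} {a : ℂ}
    (h : ∀ j, EdgeL2.primitive (T.length j) (T.length j) (g j) = -a) :
    ∃ z : T.H1e, T.dx z = g ∧ T.nodeValue z = a := by
  choose w hw using fun j => EdgeL2.exists_isACRep (T.length_pos j).le (g j) a
  have hl : ∀ j, a + ∫ s in (0 : ℝ)..T.length j, g j s = 0 := fun j => by
    rw [← EdgeL2.primitive_apply (Set.right_mem_Icc.2 (T.length_pos j).le), h, add_neg_cancel]
  refine ⟨ofIsACRep _ (WithLp.toLp 2 w) g hw hl fun j k => by simp, rfl, ?_⟩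
  rw [← rep_zero _ 0, rep_ofIsACRep hw hl (fun j k => by simp) 0
    (Set.left_mem_Icc.2 (T.length_pos 0).le)]
  simp

theorem inner_incl_add_inner_dx {v z : T.H1e} {p : Fin N → ℝ → ℂ} {q : T.L2}
    (hp : ∀ j, IsACRep (T.length j) (p j) (T.dx v j) (q j)) :
    inner ℂ q (T.incl z) + inner ℂ (T.dx v) (T.dx z) =
      -inner ℂ (∑ j, p j 0) (T.nodeValue z) := by
  rw [PiLp.inner_apply, PiLp.inner_apply, ← Finset.sum_add_distrib, sum_inner,
    ← Finset.sum_neg_distrib]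
  refine Finset.sum_congr rfl fun j _ => ?_
  rw [(hp j).inner_add_inner (T.length_pos j).le (rep_spec z j), rep_length, rep_zero,
    RCLike.inner_apply]
  ring

theorem exists_nodeValue_eq_one (T : StarNetwork N) : ∃ z : T.H1e, T.nodeValue z = 1 := by
  obtain ⟨z, -, hz⟩ := exists_dx_eq (T := T) (a := 1)
    (g := WithLp.toLp 2 fun j => EdgeL2.const (T.length j) (-(1 / T.length j : ℝ))) fun j => by
      have h : (T.length j : ℂ) ≠ 0 := Complex.ofReal_ne_zero.2 (T.length_pos j).ne'
      rw [EdgeL2.primitive_const (Set.right_mem_Icc.2 (T.length_pos j).le)]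
      push_cast
      field_simp
  exact ⟨z, hz⟩

theorem SatisfiesLBBM.eq_generator {α : ℝ} {u v : T.H1e} (h : T.SatisfiesLBBM α u v) :
    v = T.generator α u := by
  obtain ⟨p, q, hp, hq, h0⟩ := h
  refine ext_inner_right ℂ fun z => ?_
  have h1 := inner_incl_add_inner_dx (z := z) hp
  have h2 : T.incl v = q - T.dx u := by
    rw [eq_sub_iff_add_eq, ← sub_eq_zero, ← hq]; abel
  rw [inner_eq, h2, inner_sub_left, inner_generator]
  rw [h0, ← smul_eq_mul, inner_smul_left, Complex.conj_ofReal] at h1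
  linear_combination h1

theorem exists_isACRep_dx {α : ℝ} {u v : T.H1e} (h : v = T.generator α u) :
    ∃ p : Fin N → ℝ → ℂ,
      ∀ j, IsACRep (T.length j) (p j) (T.dx v j) ((T.incl v + T.dx u) j) := by
  set q : T.L2 := T.incl v + T.dx u with hq
  choose Q hQ using fun j => EdgeL2.exists_isACRep (T.length_pos j).le (q j) 0
  let c : Fin N → ℂ := fun j =>
    EdgeL2.primitive (T.length j) (T.length j) (T.dx v j - Q j) / T.length j
  let g : T.L2 := WithLp.toLp 2 fun j => T.dx v j - Q j - EdgeL2.const (T.length j) (c j)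
  have hgj : ∀ j, g j = T.dx v j - Q j - EdgeL2.const (T.length j) (c j) := fun j => rfl
  have hg0 : ∀ j, EdgeL2.primitive (T.length j) (T.length j) (g j) = -0 := fun j => by
    have h : (T.length j : ℂ) ≠ 0 := Complex.ofReal_ne_zero.2 (T.length_pos j).ne'
    rw [hgj, map_sub, EdgeL2.primitive_const (Set.right_mem_Icc.2 (T.length_pos j).le)]
    simp only [c]
    field_simp
    simp
  obtain ⟨z, hzg, hz0⟩ := exists_dx_eq hg0
  have h1 : inner ℂ v z = inner ℂ (T.generator α u) z := by rw [h]
  have h2 : inner ℂ q (T.incl z) + inner ℂ (T.dx v) g = 0 := by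
    rw [inner_eq, inner_generator, hz0, inner_zero_right, hzg] at h1
    rw [hq, inner_add_left]
    linear_combination h1
  have h3 : inner ℂ q (T.incl z) + inner ℂ (WithLp.toLp 2 Q : T.L2) g = 0 := by
    rw [PiLp.inner_apply, PiLp.inner_apply, ← Finset.sum_add_distrib]
    refine Finset.sum_eq_zero fun j _ => ?_
    rw [← hzg]
    have := (hQ j).inner_add_inner (T.length_pos j).le (rep_spec z j)
    rw [rep_length, rep_zero, hz0] at this
    simpa using this
  have h4 : inner ℂ (WithLp.toLp 2 fun j => EdgeL2.const (T.length j) (c j) : T.L2) g = 0 := by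
    rw [PiLp.inner_apply]
    refine Finset.sum_eq_zero fun j _ => ?_
    have := EdgeL2.inner_const_left (T.length_pos j).le (c j) (g j)
    rwa [hg0, neg_zero, mul_zero] at this
  have h5 : g = T.dx v - (WithLp.toLp 2 Q : T.L2) -
      (WithLp.toLp 2 fun j => EdgeL2.const (T.length j) (c j) : T.L2) := rfl
  have h6 : inner ℂ g g = 0 := by
    nth_rewrite 1 [h5]
    rw [inner_sub_left, inner_sub_left, h4]
    linear_combination h2 - h3
  have h7 : g = 0 := inner_self_eq_zero.1 h6
  refine ⟨fun j x => c j + (0 + ∫ s in (0 : ℝ)..x, q j s), fun j => ?_⟩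
  have h8 := (IsACRep.const (T.length j) (c j)).add (hQ j)
  have h9 : EdgeL2.const (T.length j) (c j) + Q j = T.dx v j := by
    have := hgj j
    rw [h7, PiLp.zero_apply] at this
    rw [eq_comm, sub_sub, sub_eq_zero] at this
    rw [this, add_comm]
  rwa [h9, zero_add] at h8

theorem satisfiesLBBM_iff {α : ℝ} {u v : T.H1e} :
    T.SatisfiesLBBM α u v ↔ v = T.generator α u := by
  refine ⟨fun h => h.eq_generator, fun h => ?_⟩
  obtain ⟨p, hp⟩ := exists_isACRep_dx h
  refine ⟨p, T.incl v + T.dx u, hp, by abel, ?_⟩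
  obtain ⟨z, hz⟩ := T.exists_nodeValue_eq_one
  have h1 : inner ℂ v z = inner ℂ (T.generator α u) z := by rw [h]
  have h2 := inner_incl_add_inner_dx (z := z) hp
  rw [inner_eq, inner_generator, hz] at h1
  rw [inner_add_left, hz] at h2
  have h3 : inner ℂ (∑ j, p j 0) (1 : ℂ) = inner ℂ ((α : ℂ) * T.nodeValue u) (1 : ℂ) := by
    rw [← smul_eq_mul, inner_smul_left, Complex.conj_ofReal]
    linear_combination h2 - h1
  simpa using congrArg (starRingEnd ℂ) h3

theorem isLBBMSolution_iff {α : ℝ} {u₀ : T.H1e} {u : ℝ → T.H1e} :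
    T.IsLBBMSolution α u₀ u ↔ ∀ t ≥ 0, u t = T.semigroup α t u₀ := by
  constructor
  · intro h t ht
    rw [← h.initial]
    refine eq_exp_of_hasDerivAt_pos h.continuousOn (fun s hs => ?_) ht
    obtain ⟨v, hv, hs⟩ := h.equation s hs
    rwa [hs.eq_generator] at hv
  · intro h
    have hd : ∀ t, HasDerivAt (fun t => T.semigroup α t u₀) (T.generator α (T.semigroup α t u₀)) t :=
      hasDerivAt_exp_ofReal_smul_apply (T.generator α) u₀
    refine ⟨?_, ?_, fun t ht => ⟨T.generator α (u t), ?_, satisfiesLBBM_iff.2 rfl⟩⟩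
    · exact ContinuousOn.congr (fun t _ => (hd t).continuousAt.continuousWithinAt) h
    · rw [h 0 le_rfl]
      exact exp_ofReal_smul_zero_apply _ _
    · rw [h t ht.le]
      refine (hd t).congr_of_eventuallyEq ?_
      filter_upwards [lt_mem_nhds ht] with s hs
      exact h s hs.le

end StarNetwork

section ODE

variable {L : ℝ}

theorem IsACRep.hasDerivWithinAt_Ici {F g : ℝ → ℂ} {v dv : EdgeL2 L} (hL : 0 < L)
    (hF : IsACRep L F v dv) (hdv : dv =ᵐ[volume.restrict (Set.Ioc (0 : ℝ) L)] g)
    (hg : ContinuousOn g (Set.Icc 0 L)) {x : ℝ} (hx : x ∈ Set.Ico 0 L) :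
    HasDerivWithinAt F (g x) (Set.Ici x) x := by
  have hgi : IntervalIntegrable g volume 0 L := by
    rw [← Set.uIcc_of_le hL.le] at hg
    exact hg.intervalIntegrable
  have hxI := Set.Ico_subset_Icc_self hx
  have hIoc : Set.Ioc x L ∈ 𝓝[>] x := Ioc_mem_nhdsGT hx.2
  have hc : ContinuousWithinAt g (Set.Ioi x) x :=
    ((hg x hxI).mono (Set.Ioc_subset_Icc_self.trans (Set.Icc_subset_Icc_left hx.1))).mono_of_mem_nhdsWithin
      hIoc
  have hm : StronglyMeasurableAtFilter g (𝓝[>] x) volume := by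
    refine ⟨Set.Ioc x L, hIoc, ?_⟩
    exact (hg.mono (Set.Ioc_subset_Icc_self.trans (Set.Icc_subset_Icc_left hx.1))).aestronglyMeasurable
      measurableSet_Ioc
  have h1 : HasDerivWithinAt (fun y => F 0 + ∫ s in (0 : ℝ)..y, g s) (g x) (Set.Ici x) x :=
    (intervalIntegral.integral_hasDerivWithinAt_right
      (hgi.mono_set (by
        rw [Set.uIcc_of_le hL.le, Set.uIcc_of_le hx.1]
        exact Set.Icc_subset_Icc_right hx.2.le)) hm hc).const_add (F 0)
  have h2 : ∀ y ∈ Set.Icc 0 L, F y = F 0 + ∫ s in (0 : ℝ)..y, g s := fun y hy => by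
    rw [hF.2 y hy, EdgeL2.integral_congr hdv hy]
  refine h1.congr_of_eventuallyEq ?_ (h2 x hxI)
  filter_upwards [Icc_mem_nhdsGE hx.2] with y hy
  exact h2 y ⟨hx.1.trans hy.1, hy.2⟩

theorem hasDerivAt_mul_ofReal (b : ℂ) (x : ℝ) : HasDerivAt (fun x : ℝ => b * (x : ℂ)) b x := by
  simpa using ((hasDerivAt_id x).ofReal_comp).const_mul b

theorem hasDerivAt_sin_mul_ofReal (b : ℂ) (x : ℝ) :
    HasDerivAt (fun x : ℝ => Complex.sin (b * x)) (Complex.cos (b * x) * b) x :=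
  (Complex.hasDerivAt_sin _).comp x (hasDerivAt_mul_ofReal b x)

theorem hasDerivAt_cos_mul_ofReal (b : ℂ) (x : ℝ) :
    HasDerivAt (fun x : ℝ => Complex.cos (b * x)) (-Complex.sin (b * x) * b) x :=
  (Complex.hasDerivAt_cos _).comp x (hasDerivAt_mul_ofReal b x)

/-- If `y'' = y - 2 a y'` on `[0, L]` with `y(0) = y(L) = 0`, then either `y' = 0` or
`y'(0) ≠ 0` and `sin (ω L) = 0`, where `± i ω - a` are the characteristic roots. -/
theorem deriv_eq_zero_or_sin_eq_zero (hL : 0 < L) {a ω : ℂ} (hω : ω ^ 2 = -(1 + a ^ 2))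
    {y s : ℝ → ℂ} (hyc : ContinuousOn y (Set.Icc 0 L)) (hsc : ContinuousOn s (Set.Icc 0 L))
    (hy : ∀ x ∈ Set.Ico 0 L, HasDerivWithinAt y (s x) (Set.Ici x) x)
    (hs : ∀ x ∈ Set.Ico 0 L, HasDerivWithinAt s (y x - 2 * a * s x) (Set.Ici x) x)
    (hy0 : y 0 = 0) (hyL : y L = 0) :
    (∀ x ∈ Set.Icc 0 L, s x = 0) ∨ s 0 ≠ 0 ∧ ω ≠ 0 ∧ Complex.sin (ω * L) = 0 := by
  have hid : ∀ (b : ℂ) (x : ℝ), HasDerivWithinAt (fun x : ℝ => b * (x : ℂ)) b (Set.Ici x) x :=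
    fun b x => (hasDerivAt_mul_ofReal b x).hasDerivWithinAt
  have hlin : ∀ b : ℂ, ContinuousOn (fun x : ℝ => b * (x : ℂ)) (Set.Icc 0 L) := fun b =>
    Continuous.continuousOn (by fun_prop)
  set w : ℝ → ℂ := fun x => Complex.exp (a * x) * y x with hw
  set W : ℝ → ℂ := fun x => Complex.exp (a * x) * (s x + a * y x) with hW
  have hwc : ContinuousOn w (Set.Icc 0 L) := (hlin a).cexp.mul hyc
  have hWc : ContinuousOn W (Set.Icc 0 L) :=
    (hlin a).cexp.mul (hsc.add (continuousOn_const.mul hyc))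
  have hw' : ∀ x ∈ Set.Ico 0 L, HasDerivWithinAt w (W x) (Set.Ici x) x := fun x hx => by
    refine ((hid a x).cexp.mul (hy x hx)).congr_deriv ?_
    simp only [hW]; ring
  have hW' : ∀ x ∈ Set.Ico 0 L, HasDerivWithinAt W (-ω ^ 2 * w x) (Set.Ici x) x := fun x hx => by
    refine ((hid a x).cexp.mul ((hs x hx).add ((hy x hx).const_mul a))).congr_deriv ?_
    simp only [hw, hω, Pi.add_apply]; ring
  have hF := constant_of_has_deriv_right_zero
    (f := fun x : ℝ => ω * w x * Complex.cos (ω * x) - W x * Complex.sin (ω * x))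
    (((continuousOn_const.mul hwc).mul (Complex.continuous_cos.comp_continuousOn (hlin ω))).sub
      (hWc.mul (Complex.continuous_sin.comp_continuousOn (hlin ω)))) (fun x hx => by
    refine ((((hw' x hx).const_mul ω).mul (hasDerivAt_cos_mul_ofReal ω x).hasDerivWithinAt).sub
      ((hW' x hx).mul (hasDerivAt_sin_mul_ofReal ω x).hasDerivWithinAt)).congr_deriv ?_
    ring)
  have hG := constant_of_has_deriv_right_zero
    (f := fun x : ℝ => ω * w x * Complex.sin (ω * x) + W x * Complex.cos (ω * x))
    (((continuousOn_const.mul hwc).mul (Complex.continuous_sin.comp_continuousOn (hlin ω))).add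
      (hWc.mul (Complex.continuous_cos.comp_continuousOn (hlin ω)))) (fun x hx => by
    refine ((((hw' x hx).const_mul ω).mul (hasDerivAt_sin_mul_ofReal ω x).hasDerivWithinAt).add
      ((hW' x hx).mul (hasDerivAt_cos_mul_ofReal ω x).hasDerivWithinAt)).congr_deriv ?_
    ring)
  have hw0 : w 0 = 0 := by simp [hw, hy0]
  have hwL : w L = 0 := by simp [hw, hyL]
  have hW0 : W 0 = s 0 := by simp [hW, hy0]
  simp only [hw0, hW0, Complex.ofReal_zero, mul_zero, Complex.sin_zero, Complex.cos_zero,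
    sub_zero, zero_add, mul_one] at hF hG
  have hWG : ∀ x ∈ Set.Icc 0 L, W x = s 0 * Complex.cos (ω * x) := fun x hx => by
    have h1 := hF x hx
    have h2 := hG x hx
    linear_combination (-Complex.sin (ω * x)) * h1 + Complex.cos (ω * x) * h2 -
      W x * Complex.sin_sq_add_cos_sq (ω * x)
  have hLI := Set.right_mem_Icc.2 hL.le
  by_cases h0 : s 0 = 0
  · left
    have hwz := constant_of_has_deriv_right_zero hwc fun x hx => by
      have := hw' x hx
      rwa [hWG x (Set.Ico_subset_Icc_self hx), h0, zero_mul] at this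
    intro x hx
    have h1 := hwz x hx
    rw [hw0] at h1
    have h2 : y x = 0 := by simpa [hw, Complex.exp_ne_zero] using h1
    have h3 := hWG x hx
    rw [h0, zero_mul] at h3
    simpa [hW, h2, Complex.exp_ne_zero] using h3
  · refine Or.inr ⟨h0, ?_⟩
    constructor
    · rintro rfl
      have h1 := constant_of_has_deriv_right_zero (f := fun x : ℝ => w x - s 0 * x)
        (hwc.sub (hlin _)) (fun x hx => by
          refine ((hw' x hx).sub (hid (s 0) x)).congr_deriv ?_
          rw [hWG x (Set.Ico_subset_Icc_self hx)]
          simp) L hLI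
      simp [hw0, hwL, h0, hL.ne'] at h1
    · have h1 := hF L hLI
      have h2 := hG L hLI
      rw [hwL] at h1 h2
      have h3 : s 0 * Complex.sin (ω * L) = 0 := by
        linear_combination (-Complex.cos (ω * L)) * h1 - Complex.sin (ω * L) * h2
      exact (mul_eq_zero.1 h3).resolve_left h0

theorem exists_div_eq_of_sin_eq_zero {ω : ℂ} (hω : ω ≠ 0) {L₁ L₂ : ℝ} (h₂ : 0 < L₂)
    (hs₁ : Complex.sin (ω * L₁) = 0) (hs₂ : Complex.sin (ω * L₂) = 0) :
    ¬Irrational (L₁ / L₂) := by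
  obtain ⟨k, hk⟩ := Complex.sin_eq_zero_iff.1 hs₁
  obtain ⟨m, hm⟩ := Complex.sin_eq_zero_iff.1 hs₂
  have hL2 : (L₂ : ℂ) ≠ 0 := by exact_mod_cast h₂.ne'
  have hm0 : (m : ℂ) ≠ 0 := by
    intro h
    rw [h, zero_mul] at hm
    exact mul_ne_zero hω hL2 hm
  have h : ((L₁ / L₂ : ℝ) : ℂ) = (((k / m : ℚ) : ℝ) : ℂ) := by
    push_cast
    rw [div_eq_div_iff hL2 hm0]
    refine mul_left_cancel₀ (mul_ne_zero hω (Complex.ofReal_ne_zero.2 Real.pi_ne_zero)) ?_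
    linear_combination (m * Real.pi) * hk - (k * Real.pi) * hm
  rw [Irrational, not_not]
  exact ⟨k / m, (Complex.ofReal_injective h).symm⟩

end ODE

namespace StarNetwork

variable {N : ℕ} {T : StarNetwork N}

theorem eq_zero_of_dx_eq_zero {z : T.H1e} (h : T.dx z = 0) : z = 0 := by
  refine ext_incl_dx ?_ (by rw [h, map_zero])
  rw [map_zero]
  refine PiLp.ext fun j => ?_
  have hr := rep_spec z j
  have hL := (T.length_pos j)
  rw [h] at hr
  have h1 : ∀ x ∈ Set.Icc 0 (T.length j), rep z j x = rep z j 0 := fun x hx => by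
    rw [hr.2 x hx, PiLp.zero_apply, EdgeL2.integral_congr (Lp.coeFn_zero _ _ _) hx]
    simp
  have h2 := h1 _ (Set.right_mem_Icc.2 hL.le)
  rw [rep_length] at h2
  rw [PiLp.zero_apply, Lp.eq_zero_iff_ae_eq_zero]
  filter_upwards [hr.1, ae_restrict_mem measurableSet_Ioc] with x hx hm
  rw [hx, h1 x (Set.Ioc_subset_Icc_self hm), ← h2]
  rfl

variable [NeZero N]

theorem eq_zero_of_generator_eq_zero {α : ℝ} {z : T.H1e} (h : T.generator α z = 0) : z = 0 := by
  obtain ⟨p, q, hp, hq, -⟩ := satisfiesLBBM_iff.2 h.symm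
  rw [map_zero, zero_sub, neg_add_eq_zero] at hq
  refine eq_zero_of_dx_eq_zero (hq ▸ PiLp.ext fun j => ?_)
  have hj := hp j
  rw [map_zero, PiLp.zero_apply] at hj
  have h1 := hj.eqOn (T.length_pos j) (IsACRep.zero _)
  refine eq_zero_of_primitive_eq_zero _ (T.length_pos j) fun x hx => ?_
  have h2 := hj.2 x hx
  rw [h1 hx, h1 (Set.left_mem_Icc.2 (T.length_pos j).le), zero_add] at h2
  exact h2.symm

theorem eq_zero_of_generator_eq_smul {α : ℝ}
    (hirr : ∀ i j : Fin N, i ≠ j → Irrational (T.length i / T.length j)) {μ : ℝ} {z : T.H1e}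
    (h : T.generator α z = (μ * Complex.I) • z) (hν : T.nodeValue z = 0) : z = 0 := by
  rcases eq_or_ne μ 0 with rfl | hμ
  · exact eq_zero_of_generator_eq_zero (α := α) (by simp [h])
  obtain ⟨p, q, hp, hq, hsum⟩ := satisfiesLBBM_iff.2 h.symm
  have hμ' : (μ : ℂ) ≠ 0 := Complex.ofReal_ne_zero.2 hμ
  set a : ℂ := Complex.I / (2 * μ) with ha
  obtain ⟨ω, hω⟩ := IsAlgClosed.exists_pow_nat_eq (-(1 + a ^ 2)) (n := 2) two_pos
  set s : Fin N → ℝ → ℂ := fun j x => (μ * Complex.I)⁻¹ * p j x with hsdef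
  have hc : (μ * Complex.I : ℂ) ≠ 0 := mul_ne_zero hμ' Complex.I_ne_zero
  have ha2 : (μ * Complex.I : ℂ)⁻¹ = -(2 * a) := by
    rw [ha]; field_simp; rw [Complex.I_sq, neg_neg]
  have hsrep : ∀ j, IsACRep (T.length j) (s j) (T.dx z j) ((μ * Complex.I : ℂ)⁻¹ • q j) :=
    fun j => by
      have := (hp j).smul (μ * Complex.I : ℂ)⁻¹
      rwa [map_smul, PiLp.smul_apply, smul_smul, inv_mul_cancel₀ hc, one_smul] at this
  have hqj : ∀ j, (μ * Complex.I : ℂ)⁻¹ • q j =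
      T.incl z j + (μ * Complex.I : ℂ)⁻¹ • T.dx z j := fun j => by
    have h1 : q = (μ * Complex.I : ℂ) • T.incl z + T.dx z := by
      rw [map_smul] at hq
      rw [← sub_eq_zero, ← neg_eq_zero, ← hq]; abel
    rw [h1, PiLp.add_apply, PiLp.smul_apply, smul_add, smul_smul, inv_mul_cancel₀ hc, one_smul]
  have hedge : ∀ j, (∀ x ∈ Set.Icc 0 (T.length j), s j x = 0) ∨
      s j 0 ≠ 0 ∧ ω ≠ 0 ∧ Complex.sin (ω * T.length j) = 0 := fun j => by
    have hL := T.length_pos j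
    have hyc := (rep_spec z j).continuousOn hL.le
    have hsc := (hsrep j).continuousOn hL.le
    refine deriv_eq_zero_or_sin_eq_zero hL hω hyc hsc
      (fun x hx => (rep_spec z j).hasDerivWithinAt_Ici hL (hsrep j).1 hsc hx)
      (fun x hx => (hsrep j).hasDerivWithinAt_Ici
        (g := fun x => rep z j x - 2 * a * s j x) hL ?_
        (hyc.sub (continuousOn_const.mul hsc)) hx)
      ((rep_zero z j).trans hν) (rep_length z j)
    rw [hqj]
    filter_upwards [Lp.coeFn_add (T.incl z j) ((μ * Complex.I : ℂ)⁻¹ • T.dx z j),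
      Lp.coeFn_smul (μ * Complex.I : ℂ)⁻¹ (T.dx z j), (rep_spec z j).1, (hsrep j).1]
      with x h1 h2 h3 h4
    rw [h1, Pi.add_apply, h2, Pi.smul_apply, h3, h4, ha2, smul_eq_mul]
    ring
  have hs0 : ∑ j, s j 0 = 0 := by
    simp only [hsdef]
    rw [← Finset.mul_sum, hsum, hν, mul_zero, mul_zero]
  have hall : ∀ j, ∀ x ∈ Set.Icc 0 (T.length j), s j x = 0 := by
    intro i
    by_contra hi
    obtain ⟨hsi0, hω0, hsi⟩ := (hedge i).resolve_left hi
    have hothers : ∀ j ≠ i, ∀ x ∈ Set.Icc 0 (T.length j), s j x = 0 := fun j hj => by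
      refine (hedge j).resolve_right fun hsj => ?_
      exact exists_div_eq_of_sin_eq_zero hω0 (T.length_pos i) hsj.2.2 hsi (hirr j i hj)
    rw [Finset.sum_eq_single_of_mem i (Finset.mem_univ i) fun j _ hj =>
      hothers j hj 0 (Set.left_mem_Icc.2 (T.length_pos j).le)] at hs0
    exact hsi0 hs0
  refine eq_zero_of_dx_eq_zero (PiLp.ext fun j => ?_)
  rw [PiLp.zero_apply, Lp.eq_zero_iff_ae_eq_zero]
  filter_upwards [(hsrep j).1, ae_restrict_mem measurableSet_Ioc] with x hx hm
  rw [hx, hall j x (Set.Ioc_subset_Icc_self hm)]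
  rfl

end StarNetwork

/-- The class in `L²(0, L)` of a continuous function. -/
noncomputable def EdgeL2.ofContinuous (L : ℝ) (f : C(ℝ, ℂ)) : EdgeL2 L :=
  MemLp.toLp f <| by
    obtain ⟨C, hC⟩ := isCompact_Icc.exists_bound_of_continuousOn
      (f.continuous.continuousOn (s := Set.Icc 0 L))
    refine MemLp.of_bound f.continuous.aestronglyMeasurable C ?_
    filter_upwards [ae_restrict_mem measurableSet_Ioc] with x hx
    exact hC x (Set.Ioc_subset_Icc_self hx)

theorem EdgeL2.ofContinuous_ae (L : ℝ) (f : C(ℝ, ℂ)) :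
    EdgeL2.ofContinuous L f =ᵐ[volume.restrict (Set.Ioc (0 : ℝ) L)] f :=
  MemLp.coeFn_toLp _

theorem IsACRep.ofContinuous (L : ℝ) (f f' : C(ℝ, ℂ)) (h : ∀ x, HasDerivAt f (f' x) x) :
    IsACRep L f (EdgeL2.ofContinuous L f) (EdgeL2.ofContinuous L f') := by
  refine ⟨EdgeL2.ofContinuous_ae L f, fun x hx => ?_⟩
  rw [EdgeL2.integral_congr (EdgeL2.ofContinuous_ae L f') hx,
    intervalIntegral.integral_eq_sub_of_hasDerivAt (fun y _ => h y)
      (f'.continuous.intervalIntegrable _ _)]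
  ring

namespace StarNetwork

variable {N : ℕ} [NeZero N] {T : StarNetwork N}

/-- If `ω ℓᵢ` and `ω ℓⱼ` are both multiples of `π`, with `ω > 0` and `i ≠ j`, then `𝒜` has a purely
imaginary eigenvalue. -/
theorem exists_generator_eq_smul (α : ℝ) {i j : Fin N} (hij : i ≠ j) {ω : ℝ} (hω : 0 < ω)
    (hi : Real.sin (ω * T.length i) = 0) (hj : Real.sin (ω * T.length j) = 0) :
    ∃ (μ : ℝ) (z : T.H1e), z ≠ 0 ∧ T.generator α z = (μ * Complex.I) • z := by
  obtain ⟨r, hr, hr0⟩ : ∃ r : ℝ, r ^ 2 = 1 + ω ^ 2 ∧ r ≠ 0 :=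
    ⟨Real.sqrt (1 + ω ^ 2), Real.sq_sqrt (by positivity), (Real.sqrt_pos.2 (by positivity)).ne'⟩
  have hrC : (r : ℂ) ^ 2 = 1 + (ω : ℂ) ^ 2 := by exact_mod_cast hr
  have hrC0 : (r : ℂ) ≠ 0 := Complex.ofReal_ne_zero.2 hr0
  set a : ℂ := r * Complex.I with ha
  have ha2 : a ^ 2 = -(1 + (ω : ℂ) ^ 2) := by rw [ha, mul_pow, hrC, Complex.I_sq]; ring
  let y : C(ℝ, ℂ) := ⟨fun x => Complex.exp (-a * x) * Complex.sin (ω * x), by fun_prop⟩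
  let s : C(ℝ, ℂ) := ⟨fun x => Complex.exp (-a * x) *
    (ω * Complex.cos (ω * x) - a * Complex.sin (ω * x)), by fun_prop⟩
  have hy : ∀ x, HasDerivAt y (s x) x := fun x => by
    refine ((hasDerivAt_mul_ofReal (-a) x).cexp.mul (hasDerivAt_sin_mul_ofReal ω x)).congr_deriv ?_
    simp only [s, ContinuousMap.coe_mk]
    ring
  have hs : ∀ x, HasDerivAt s ((y - (2 * a) • s) x) x := fun x => by
    refine ((hasDerivAt_mul_ofReal (-a) x).cexp.mul
      (((hasDerivAt_cos_mul_ofReal ω x).const_mul (ω : ℂ)).sub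
      ((hasDerivAt_sin_mul_ofReal ω x).const_mul a))).congr_deriv ?_
    simp only [s, y, ContinuousMap.coe_mk, ContinuousMap.sub_apply, ContinuousMap.smul_apply,
      smul_eq_mul, Pi.sub_apply]
    linear_combination (-Complex.exp (-a * x) * Complex.sin (ω * x)) * ha2
  let c : Fin N → ℂ := fun k => if k = i then 1 else if k = j then -1 else 0
  have hci : c i = 1 := if_pos rfl
  have hcsum : ∑ k, c k = 0 := by
    have : ∀ k, c k = (if k = i then 1 else 0) + (if k = j then -1 else 0) := fun k => by
      by_cases h1 : k = i
      · have : k ≠ j := h1 ▸ hij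
        simp [c, h1, hij]
      · simp [c, h1]
    simp [this, Finset.sum_add_distrib]
  have hyrep : ∀ k, IsACRep (T.length k) (fun x => c k * y x)
      (c k • EdgeL2.ofContinuous (T.length k) y) (c k • EdgeL2.ofContinuous (T.length k) s) :=
    fun k => (IsACRep.ofContinuous _ y s hy).smul (c k)
  have hsrep : ∀ k, IsACRep (T.length k) s (EdgeL2.ofContinuous (T.length k) s)
      (EdgeL2.ofContinuous (T.length k) (y - (2 * a) • s)) :=
    fun k => IsACRep.ofContinuous _ s _ hs
  have hy0 : y 0 = 0 := by simp [y]
  have hyL : ∀ k, c k * y (T.length k) = 0 := fun k => by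
    by_cases h1 : k = i
    · subst h1
      have : Complex.sin (ω * T.length k) = 0 := by exact_mod_cast hi
      simp [y, this]
    by_cases h2 : k = j
    · subst h2
      have : Complex.sin (ω * T.length k) = 0 := by exact_mod_cast hj
      simp [y, this]
    · simp [c, h1, h2]
  let v : T.L2 := WithLp.toLp 2 fun k => c k • EdgeL2.ofContinuous (T.length k) y
  let dv : T.L2 := WithLp.toLp 2 fun k => c k • EdgeL2.ofContinuous (T.length k) s
  let z : T.H1e := ofIsACRep (fun k x => c k * y x) v dv hyrep hyL fun k l => by simp [hy0]
  have hzrep : ∀ k, Set.EqOn (rep z k) (fun x => c k * y x) (Set.Icc 0 (T.length k)) :=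
    rep_ofIsACRep hyrep hyL _
  have hν : T.nodeValue z = 0 := by
    rw [← rep_zero z 0, hzrep 0 (Set.left_mem_Icc.2 (T.length_pos 0).le)]
    simp [hy0]
  let m : ℂ := ((1 / (2 * r) : ℝ) : ℂ) * Complex.I
  have hm : m * (2 * a) = -1 := by
    simp only [m, ha]
    push_cast
    field_simp
    rw [Complex.I_sq]
  refine ⟨1 / (2 * r), z, fun hz => ?_, ?_⟩
  · have hL := T.length_pos i
    have hsz : EdgeL2.ofContinuous (T.length i) s = 0 := by
      have h1 : T.dx z i = c i • EdgeL2.ofContinuous (T.length i) s := rfl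
      rw [hz, map_zero, hci, one_smul] at h1
      exact h1.symm
    have h2 := (hsrep i).eqOn hL (hsz ▸ IsACRep.zero _) (Set.left_mem_Icc.2 hL.le)
    simp [s, hω.ne'] at h2
  · refine (satisfiesLBBM_iff.1 ⟨fun k x => (m * c k) * s x,
      WithLp.toLp 2 fun k => (m * c k) • EdgeL2.ofContinuous (T.length k) (y - (2 * a) • s),
      fun k => ?_, ?_, ?_⟩).symm
    · have := (hsrep k).smul (m * c k)
      rwa [mul_smul] at this
    · refine PiLp.ext fun k => ?_
      have h1 : EdgeL2.ofContinuous (T.length k) (y - (2 * a) • s) =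
          EdgeL2.ofContinuous (T.length k) y - (2 * a) • EdgeL2.ofContinuous (T.length k) s := rfl
      have h2 : T.incl (m • z) k = m • c k • EdgeL2.ofContinuous (T.length k) y := rfl
      have h3 : T.dx z k = c k • EdgeL2.ofContinuous (T.length k) s := rfl
      rw [PiLp.add_apply, PiLp.sub_apply, PiLp.zero_apply, h2, h3]
      change _ - (m * c k) • EdgeL2.ofContinuous (T.length k) (y - (2 * a) • s) + _ = 0
      rw [h1, smul_sub, smul_smul, smul_smul,
        show m * c k * (2 * a) = -c k by linear_combination c k * hm]
      module
    · rw [hν, mul_zero, ← Finset.sum_mul, ← Finset.mul_sum, hcsum]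
      simp

theorem exists_pos_sin_eq_zero {a b : ℝ} (hb : 0 < b)
    (h : ¬Irrational (a / b)) :
    ∃ ω : ℝ, 0 < ω ∧ Real.sin (ω * a) = 0 ∧ Real.sin (ω * b) = 0 := by
  rw [Irrational, not_not] at h
  obtain ⟨q, hq⟩ := h
  have hden : (q.den : ℝ) ≠ 0 := Nat.cast_ne_zero.2 q.den_nz
  have h1 : (q.den : ℝ) * a = q.num * b := by
    have h2 : (q : ℝ) = q.num / q.den := by exact_mod_cast (Rat.num_div_den q).symm
    rw [h2, div_eq_div_iff hden hb.ne'] at hq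
    linarith
  refine ⟨q.den * Real.pi / b, ?_, ?_, ?_⟩
  · have : (0 : ℝ) < q.den := Nat.cast_pos.2 q.den_pos
    positivity
  · rw [show q.den * Real.pi / b * a = q.num * Real.pi by
      field_simp; linear_combination h1]
    exact Real.sin_int_mul_pi _
  · rw [div_mul_cancel₀ _ hb.ne']
    exact Real.sin_nat_mul_pi _

end StarNetwork

theorem mainTheorem1 (N : ℕ) [NeZero N] (T : StarNetwork N) (α : ℝ) (hα : (N : ℝ) / 2 < α) :
    (∀ (u₀ : T.H1e) (u : ℝ → T.H1e),
      T.IsLBBMSolution α u₀ u ↔ ∀ t ≥ 0, u t = T.semigroup α t u₀) ∧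
    ((∀ u₀ : T.H1e, Tendsto (fun t : ℝ => ‖T.semigroup α t u₀‖) atTop (𝓝 0)) ↔
      ∀ i j : Fin N, i ≠ j → Irrational (T.length i / T.length j)) := by
  refine ⟨fun _ _ => StarNetwork.isLBBMSolution_iff, fun h i j hij => ?_, fun h u₀ => ?_⟩
  · by_contra hr
    obtain ⟨ω, hω, hi, hj⟩ :=
      StarNetwork.exists_pos_sin_eq_zero (T.length_pos j) hr
    obtain ⟨μ, z, hz, hAz⟩ := StarNetwork.exists_generator_eq_smul α hij hω hi hj
    have h1 : Tendsto (fun t : ℝ => ‖T.semigroup α t z‖) atTop (𝓝 ‖z‖) := by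
      refine tendsto_const_nhds.congr' ?_
      filter_upwards [eventually_ge_atTop 0] with t ht
      have h2 : T.semigroup α t z = Complex.exp (μ * Complex.I * t) • z :=
        exp_ofReal_smul_apply_of_eigenvector hAz ht
      rw [h2, norm_smul, mul_right_comm, ← Complex.ofReal_mul, Complex.norm_exp_ofReal_mul_I,
        one_mul]
    exact hz (norm_eq_zero.1 (tendsto_nhds_unique h1 (h z)))
  · exact tendsto_norm_exp_apply_of_no_eigenvector (sub_pos.2 hα)
      (T.isCompactOperator_generator α) (StarNetwork.inner_generator_add α)
      (fun μ z hz hν => StarNetwork.eq_zero_of_generator_eq_smul h hz hν) u₀
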